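/- Let $\{X_n,\ n\ge 1\}$ be a strictly stationary sequence of real random variables with mean $\mu$, variance $\sigma^2>0$ and first-order autocorrelation $\rho_1=\operatorname{Cov}(X_1,X_2)/\sigma^2$. Assume that one of the following holds: (i) $\{X_n\}$ is $m$-dependent for some integer $m\ge 0$ (that is, $(X_i)_{i\le k}$ and $(X_i)_{i\ge k+m+1}$ are independent for every $k$), and $\mathbb E[X_1^4]<\infty$; (ii) $\{X_n\}$ is $\alpha$-mixing and, for some $\delta>0$, $\mathbb E\,|X_1|^{4+2\delta}<\infty$ and $\sum_{n\ge 1}\alpha_X(n)^{\delta/(2+\delta)}<\infty$, where $$\alpha_X(n)=\sup_{k\ge 1}\ \sup\{|\mathbb P(A\cap B)-\mathbb P(A)\mathbb P(B)| : A\in\sigma(X_i,\,i\le k),\ B\in\sigma(X_i,\,i\ge k+n)\}.$$ Let $\bar X_n=\frac1n\sum_{i=1}^n X_i$, $\hat\sigma_n^2=\frac1n\sum_{i=1}^n (X_i-\bar X_n)^2$, and let $$\hat\rho_n=\frac{\frac1n\sum_{i=1}^{n-1}(X_i-\bar X_n)(X_{i+1}-\bar X_n)}{\hat\sigma_n^2}$$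 be the first-order sample autocorrelation (with value $0$, say, when $\hat\sigma_n^2=0$). Put $x_i=X_i-\mu$ and $$\tau_1^2=\operatorname{Var}(x_1x_2)+2\sum_{k\ge2}\operatorname{Cov}(x_1x_2,\,x_kx_{k+1}),\qquad \kappa^2=\operatorname{Var}(x_1^2)+2\sum_{k\ge2}\operatorname{Cov}(x_1^2,\,x_k^2),$$ $$\nu_1=\operatorname{Cov}(x_1x_2,\,x_1^2)+\sum_{k\ge2}\operatorname{Cov}(x_1^2,\,x_kx_{k+1})+\sum_{k\ge2}\operatorname{Cov}(x_1x_2,\,x_k^2),$$ $$\gamma_1^2=\frac1{\sigma^4}\left(\tau_1^2-2\rho_1\nu_1+\rho_1^2\kappa^2\right).$$ Then these four series converge absolutely, $\gamma_1^2\ge 0$, and, as $n\to\infty$, $$\sqrt n\,(\hat\rho_n-\rho_1)\ \xrightarrow{\ d\ }\ N(0,\gamma_1^2),$$ where $N(0,0)$ denotes the point mass at $0$. -/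

import Mathlib

open MeasureTheory ProbabilityTheory Filter Topology

namespace TimeSeries

/-! A time series is a sequence `X : ℕ → Ω → ℝ` of real random variables. Indices start at `0`:
`X i` stands for the variable that is usually written with the index `i + 1`. -/

noncomputable section

variable {Ω : Type*} [MeasurableSpace Ω]

/-- Strict stationarity: for every shift `k`, the process `(X (i + k))_i` has the same law, on the
space of sequences with its product sigma-algebra, as `(X i)_i`. -/
def StrictlyStationary (X : ℕ → Ω → ℝ) (P : Measure Ω) : Prop :=
  ∀ k : ℕ, IdentDistrib (fun ω i => X (i + k) ω) (fun ω i => X i ω) P P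

/-- The sigma-algebra generated by the variables `X i`, `i ≤ k`. -/
@[reducible] def past (X : ℕ → Ω → ℝ) (k : ℕ) : MeasurableSpace Ω :=
  ⨆ (i : ℕ) (_ : i ≤ k), MeasurableSpace.comap (X i) inferInstance

/-- The sigma-algebra generated by the variables `X i`, `i ≥ k`. -/
@[reducible] def future (X : ℕ → Ω → ℝ) (k : ℕ) : MeasurableSpace Ω :=
  ⨆ (i : ℕ) (_ : k ≤ i), MeasurableSpace.comap (X i) inferInstance

/-- `m`-dependence: `(X i)_{i ≤ k}` and `(X i)_{i ≥ k + m + 1}` are independent, for every `k`. -/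
def MDependent (X : ℕ → Ω → ℝ) (P : Measure Ω) (m : ℕ) : Prop :=
  ∀ k : ℕ, Indep (past X k) (future X (k + m + 1)) P

/-- The `n`-th alpha-mixing coefficient: the supremum of `|P(A ∩ B) - P(A) P(B)|` over all `k`, all
events `A` of the sigma-algebra of `(X i)_{i ≤ k}` and all events `B` of the sigma-algebra of
`(X i)_{i ≥ k + n}`. -/
def alphaCoeff (X : ℕ → Ω → ℝ) (P : Measure Ω) (n : ℕ) : ℝ :=
  sSup {x : ℝ | ∃ (k : ℕ) (A B : Set Ω), MeasurableSet[past X k] A ∧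
    MeasurableSet[future X (k + n)] B ∧ x = |P.real (A ∩ B) - P.real A * P.real B|}

/-- Alpha-mixing (strong mixing): the mixing coefficients tend to zero. -/
def AlphaMixing (X : ℕ → Ω → ℝ) (P : Measure Ω) : Prop :=
  Tendsto (alphaCoeff X P) atTop (𝓝 0)

/-- The sample mean of the first `n` observations. -/
def sampleMean (X : ℕ → Ω → ℝ) (n : ℕ) (ω : Ω) : ℝ :=
  (1 / (n : ℝ)) * ∑ i ∈ Finset.range n, X i ω

/-- The sample variance (with normalization `1 / n`) of the first `n` observations. -/
def sampleVar (X : ℕ → Ω → ℝ) (n : ℕ) (ω : Ω) : ℝ :=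
  (1 / (n : ℝ)) * ∑ i ∈ Finset.range n, (X i ω - sampleMean X n ω) ^ 2

/-- The first-order sample autocorrelation of the first `n` observations. -/
def sampleAutocorr (X : ℕ → Ω → ℝ) (n : ℕ) (ω : Ω) : ℝ :=
  ((1 / (n : ℝ)) * ∑ i ∈ Finset.range (n - 1),
    (X i ω - sampleMean X n ω) * (X (i + 1) ω - sampleMean X n ω)) / sampleVar X n ω

/-- The first-order autocorrelation of a stationary series. -/
def autocorr (X : ℕ → Ω → ℝ) (P : Measure Ω) : ℝ :=
  cov[X 0, X 1; P] / Var[X 0; P]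

/-- The products of successive centred variables, `(X i - μ) (X (i + 1) - μ)`, with `μ` the common
mean. -/
def lagProd (X : ℕ → Ω → ℝ) (P : Measure Ω) (i : ℕ) (ω : Ω) : ℝ :=
  (X i ω - ∫ ω', X 0 ω' ∂P) * (X (i + 1) ω - ∫ ω', X 0 ω' ∂P)

/-- The squares of the centred variables, `(X i - μ) ^ 2`, with `μ` the common mean. -/
def centredSq (X : ℕ → Ω → ℝ) (P : Measure Ω) (i : ℕ) (ω : Ω) : ℝ :=
  (X i ω - ∫ ω', X 0 ω' ∂P) ^ 2

/-- Long-run variance of the products of successive centred variables. -/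
def tauSq (X : ℕ → Ω → ℝ) (P : Measure Ω) : ℝ :=
  Var[lagProd X P 0; P] + 2 * ∑' k : ℕ, cov[lagProd X P 0, lagProd X P (k + 1); P]

/-- Long-run variance of the squares of the centred variables. -/
def kappaSq (X : ℕ → Ω → ℝ) (P : Measure Ω) : ℝ :=
  Var[centredSq X P 0; P] + 2 * ∑' k : ℕ, cov[centredSq X P 0, centredSq X P (k + 1); P]

/-- Long-run covariance of the products and the squares. -/
def nu (X : ℕ → Ω → ℝ) (P : Measure Ω) : ℝ :=
  cov[lagProd X P 0, centredSq X P 0; P]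
    + ∑' k : ℕ, cov[centredSq X P 0, lagProd X P (k + 1); P]
    + ∑' k : ℕ, cov[lagProd X P 0, centredSq X P (k + 1); P]

/-- The asymptotic variance of the first-order sample autocorrelation. -/
def gammaSq (X : ℕ → Ω → ℝ) (P : Measure Ω) : ℝ :=
  (1 / Var[X 0; P] ^ 2) *
    (tauSq X P - 2 * autocorr X P * nu X P + autocorr X P ^ 2 * kappaSq X P)

end

end TimeSeries

/-! Write `x_i = X_i - μ`, let `ρ` be the autocorrelation and `V` the variance. The error of the
sample autocorrelation is (sample autocovariance - `ρ` · sample variance) / sample variance.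
Replacing the sample mean by `μ` and adding one boundary product changes √n times this numerator by
O(n^{-1/2}) in L¹ (`tendstoInMeasure_sampleAutocov_sub`). Since the sample variance is consistent,
Slutsky's argument leaves a central limit theorem for the score `(x_i x_{i+1} - ρ x_i²) / V`. It is
a centred function of the pair `(X_i, X_{i+1})`, and expanding its covariances bilinearly gives the
long-run variance `gammaSq` (`longRunVar_scoreFun`).

Both dependence hypotheses enter only through `CovDecay`: covariances of functions of pairs are
summable uniformly over a ball of L^p, and pairs have antitone summable mixing coefficients. Here `p
= 2` under m-dependence, while `p = 2 + δ` under mixing, by Davydov's inequality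
(`AlphaLE.abs_cov_le_rpow`).

For bounded centred `Y_j` with sum `S` and long-run variance `σ²`, the central limit theorem is
proved by a Stein-type argument on characteristic functions. Let `W_j` be the sum over the window of
radius `m` about `j`. Then `Y_j e^{isS} = Y_j e^{is(S - W_j)} + i s Y_j W_j e^{isS} + O(s² W_j²)`.
The first term has almost zero mean by mixing, the last is controlled by second moments, and `∑ Y_j
W_j` is close to `n σ²` in L¹. With `s = t/√n` the characteristic function `φ_n` of `S/√n` satisfies
`φ_n' ≈ -σ² t φ_n`, which forces it to be almost Gaussian (`norm_sub_exp_le_of_deriv`). The errors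
are of order `√n a(m+1)`, `m/√n` and tails of the covariance series. Taking `m ≈ ε√n` makes them
small, because an antitone summable sequence satisfies `k a_k → 0`.

Unbounded functions are reached by truncation at level `N`: the covariance bounds of `CovDecay` make
the L² error of the normalized sums small uniformly in `n`, so the limits in `N` and `n` may be
interchanged (`CovDecay.tendsto_charFun`). -/

namespace TimeSeries

/-! ### Covariance inequalities under alpha-mixing -/

section CovarianceInequalities

variable {Ω : Type*} {m m₁ m₂ n₁ n₂ mΩ : MeasurableSpace Ω} {P : Measure Ω} [IsProbabilityMeasure P]

lemma memLp_of_abs_le {f : Ω → ℝ} {b : ℝ} (hf : Measurable f) (hb : ∀ ω, |f ω| ≤ b)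
    (p : ENNReal) : MemLp f p P :=
  MemLp.of_bound hf.aestronglyMeasurable b (ae_of_all _ hb)

lemma nonneg_of_forall_abs_le (P : Measure Ω) [IsProbabilityMeasure P] {f : Ω → ℝ} {b : ℝ}
    (hb : ∀ ω, |f ω| ≤ b) : 0 ≤ b := by
  obtain ⟨ω⟩ := nonempty_of_isProbabilityMeasure P
  exact (abs_nonneg _).trans (hb ω)

lemma covariance_eq_integral_mul_sub {v u : Ω → ℝ} (hv : MemLp v 2 P) (hu : MemLp u 2 P) :
    cov[v, u; P] = ∫ ω, v ω * (u ω - ∫ ω', u ω' ∂P) ∂P := by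
  rw [covariance_eq_sub hv hu]
  simp_rw [mul_sub]
  have h := integral_sub (hv.integrable_mul hu)
    ((hv.integrable (by norm_num)).mul_const (∫ ω', u ω' ∂P))
  rw [integral_mul_const] at h
  exact h.symm

/-- The covariance with a bounded variable is controlled by the covariance with an event. -/
lemma exists_measurableSet_abs_cov_le (hm : m ≤ mΩ) {v u : Ω → ℝ} {b : ℝ}
    (hv : Measurable[m] v) (hvb : ∀ ω, |v ω| ≤ b) (hu : MemLp u 2 P) :
    ∃ A, MeasurableSet[m] A ∧
      |cov[v, u; P]| ≤ 2 * b * |cov[A.indicator (fun _ => (1 : ℝ)), u; P]| := by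
  have hb0 : 0 ≤ b := nonneg_of_forall_abs_le P hvb
  have hv2 : MemLp v 2 P := memLp_of_abs_le (hv.mono hm le_rfl) hvb 2
  set w : Ω → ℝ := fun ω => u ω - ∫ ω', u ω' ∂P with hw
  have hui : Integrable u P := hu.integrable (by norm_num)
  have hwi : Integrable w P := hui.sub (integrable_const _)
  have hw0 : ∫ ω, w ω ∂P = 0 := by
    rw [hw, integral_sub hui (integrable_const _)]; simp
  -- Only the projection of the centred `u` on `m` matters, and among bounded `v` the extremal
  -- choice is the sign of this projection; hence the event where it is nonnegative.
  set h : Ω → ℝ := P[w | m] with hh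
  have hhm : StronglyMeasurable[m] h := stronglyMeasurable_condExp
  have hhi : Integrable h P := integrable_condExp
  let A : Set Ω := {ω | 0 ≤ h ω}
  have hA : MeasurableSet[m] A := measurableSet_le (@measurable_const _ _ _ m _) hhm.measurable
  have hA' : MeasurableSet A := hm _ hA
  refine ⟨A, hA, ?_⟩
  have h1 : cov[v, u; P] = ∫ ω, v ω * h ω ∂P := by
    rw [covariance_eq_integral_mul_sub hv2 hu, ← integral_condExp hm]
    refine integral_congr_ae ?_
    refine condExp_mul_of_stronglyMeasurable_left hv.stronglyMeasurable ?_ hwi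
    exact hv2.integrable_mul (hu.sub (memLp_const _))
  have h2 : cov[A.indicator (fun _ => (1 : ℝ)), u; P] = ∫ ω in A, h ω ∂P := by
    rw [covariance_eq_integral_mul_sub ((memLp_const 1).indicator hA') hu,
      setIntegral_condExp hm hwi hA, ← integral_indicator hA']
    refine integral_congr_ae (ae_of_all _ fun ω => ?_)
    by_cases hω : ω ∈ A <;> simp [hω, hw]
  have h3 : ∫ ω in A, h ω ∂P + ∫ ω in Aᶜ, h ω ∂P = 0 := by
    rw [integral_add_compl hA' hhi, hh, integral_condExp hm, hw0]
  -- Since `h` has mean zero, its positive and negative parts have equal integrals; this is the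
  -- source of the factor 2.
  have h4 : ∫ ω, |h ω| ∂P = 2 * ∫ ω in A, h ω ∂P := by
    rw [← integral_add_compl hA' hhi.abs]
    have e1 : ∫ ω in A, |h ω| ∂P = ∫ ω in A, h ω ∂P :=
      setIntegral_congr_fun hA' fun ω hω => abs_of_nonneg hω
    have e2 : ∫ ω in Aᶜ, |h ω| ∂P = - ∫ ω in Aᶜ, h ω ∂P := by
      rw [← integral_neg]
      exact setIntegral_congr_fun hA'.compl fun ω hω => abs_of_neg (not_le.1 hω)
    rw [e1, e2]; linarith
  rw [h1, h2]
  calc |∫ ω, v ω * h ω ∂P| ≤ ∫ ω, b * |h ω| ∂P := by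
        rw [← Real.norm_eq_abs]
        refine norm_integral_le_of_norm_le (hhi.abs.const_mul b) (ae_of_all _ fun ω => ?_)
        rw [norm_mul]
        exact mul_le_mul_of_nonneg_right (hvb ω) (abs_nonneg _)
    _ = 2 * b * ∫ ω in A, h ω ∂P := by rw [integral_const_mul, h4]; ring
    _ ≤ _ := mul_le_mul_of_nonneg_left (le_abs_self _) (by positivity)

/-- Two sigma-algebras whose alpha-mixing coefficient is at most `a`. -/
def AlphaLE (P : @Measure Ω mΩ) (m₁ m₂ : MeasurableSpace Ω) (a : ℝ) : Prop :=
  ∀ A B, MeasurableSet[m₁] A → MeasurableSet[m₂] B → |P.real (A ∩ B) - P.real A * P.real B| ≤ a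

omit [IsProbabilityMeasure P] in
lemma AlphaLE.mono {a b : ℝ} (h : AlphaLE P m₁ m₂ a)
    (h₁ : n₁ ≤ m₁) (h₂ : n₂ ≤ m₂) (hab : a ≤ b) : AlphaLE P n₁ n₂ b :=
  fun A B hA hB => (h A B (h₁ A hA) (h₂ B hB)).trans hab

omit [IsProbabilityMeasure P] in
lemma AlphaLE.nonneg {a : ℝ} (h : AlphaLE P m₁ m₂ a) : 0 ≤ a :=
  (abs_nonneg _).trans (h ∅ ∅ (@MeasurableSet.empty _ m₁) (@MeasurableSet.empty _ m₂))

lemma covariance_indicator_one {A B : Set Ω} (hA : MeasurableSet A) (hB : MeasurableSet B) :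
    cov[A.indicator (fun _ => (1 : ℝ)), B.indicator (fun _ => (1 : ℝ)); P]
      = P.real (A ∩ B) - P.real A * P.real B := by
  rw [covariance_eq_sub ((memLp_const 1).indicator hA) ((memLp_const 1).indicator hB)]
  have : A.indicator (fun _ => (1 : ℝ)) * B.indicator (fun _ => (1 : ℝ))
      = (A ∩ B).indicator (fun _ => (1 : ℝ)) := by
    ext ω; by_cases h1 : ω ∈ A <;> by_cases h2 : ω ∈ B <;> simp [h1, h2]
  rw [this, integral_indicator_const _ (hA.inter hB), integral_indicator_const _ hA,
    integral_indicator_const _ hB]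
  simp

/-- Ibragimov's covariance inequality for bounded variables. -/
theorem AlphaLE.abs_cov_le {a : ℝ} (h : AlphaLE P m₁ m₂ a)
    (h₁ : m₁ ≤ mΩ) (h₂ : m₂ ≤ mΩ) {f g : Ω → ℝ} {b c : ℝ} (hf : Measurable[m₁] f)
    (hg : Measurable[m₂] g) (hfb : ∀ ω, |f ω| ≤ b) (hgc : ∀ ω, |g ω| ≤ c) :
    |cov[f, g; P]| ≤ 4 * (b * c) * a := by
  have hb0 : 0 ≤ b := nonneg_of_forall_abs_le P hfb
  have hc0 : 0 ≤ c := nonneg_of_forall_abs_le P hgc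
  -- Each variable in turn is replaced by an event, at the cost of factors `2b` and `2c`; what
  -- remains is the mixing coefficient of two events.
  obtain ⟨A, hA, hA'⟩ := exists_measurableSet_abs_cov_le h₁ hf hfb
    (memLp_of_abs_le (hg.mono h₂ le_rfl) hgc 2 : MemLp g 2 P)
  obtain ⟨B, hB, hB'⟩ := exists_measurableSet_abs_cov_le h₂ hg hgc
    ((memLp_const 1).indicator (h₁ A hA) : MemLp (A.indicator (fun _ => (1 : ℝ))) 2 P)
  have hAB := h A B hA hB
  rw [← covariance_indicator_one (h₁ A hA) (h₂ B hB), covariance_comm] at hAB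
  rw [covariance_comm (A.indicator _)] at hA'
  calc _ ≤ _ := hA'
    _ ≤ 2 * b * (2 * c * a) := by gcongr; exact hB'.trans (by gcongr)
    _ = _ := by ring

/-- The covariance inequality for bounded complex variables. -/
theorem AlphaLE.norm_integral_mul_sub_le {a : ℝ}
    (h : AlphaLE P m₁ m₂ a) (h₁ : m₁ ≤ mΩ) (h₂ : m₂ ≤ mΩ) {f g : Ω → ℂ} {b c : ℝ}
    (hf : Measurable[m₁] f) (hg : Measurable[m₂] g) (hfb : ∀ ω, ‖f ω‖ ≤ b)
    (hgc : ∀ ω, ‖g ω‖ ≤ c) :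
    ‖∫ ω, f ω * g ω ∂P - (∫ ω, f ω ∂P) * ∫ ω, g ω ∂P‖ ≤ 16 * (b * c) * a := by
  have hfr : Measurable[m₁] fun ω => (f ω).re := Complex.measurable_re.comp hf
  have hfi : Measurable[m₁] fun ω => (f ω).im := Complex.measurable_im.comp hf
  have hgr : Measurable[m₂] fun ω => (g ω).re := Complex.measurable_re.comp hg
  have hgi : Measurable[m₂] fun ω => (g ω).im := Complex.measurable_im.comp hg
  have bfr : ∀ ω, |(f ω).re| ≤ b := fun ω => (Complex.abs_re_le_norm _).trans (hfb ω)
  have bfi : ∀ ω, |(f ω).im| ≤ b := fun ω => (Complex.abs_im_le_norm _).trans (hfb ω)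
  have bgr : ∀ ω, |(g ω).re| ≤ c := fun ω => (Complex.abs_re_le_norm _).trans (hgc ω)
  have bgi : ∀ ω, |(g ω).im| ≤ c := fun ω => (Complex.abs_im_le_norm _).trans (hgc ω)
  have Lfr := memLp_of_abs_le (P := P) (hfr.mono h₁ le_rfl) bfr 2
  have Lfi := memLp_of_abs_le (P := P) (hfi.mono h₁ le_rfl) bfi 2
  have Lgr := memLp_of_abs_le (P := P) (hgr.mono h₂ le_rfl) bgr 2
  have Lgi := memLp_of_abs_le (P := P) (hgi.mono h₂ le_rfl) bgi 2
  have c1 := h.abs_cov_le h₁ h₂ hfr hgr bfr bgr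
  have c2 := h.abs_cov_le h₁ h₂ hfr hgi bfr bgi
  have c3 := h.abs_cov_le h₁ h₂ hfi hgr bfi bgr
  have c4 := h.abs_cov_le h₁ h₂ hfi hgi bfi bgi
  rw [covariance_eq_sub Lfr Lgr] at c1
  rw [covariance_eq_sub Lfr Lgi] at c2
  rw [covariance_eq_sub Lfi Lgr] at c3
  rw [covariance_eq_sub Lfi Lgi] at c4
  simp only [Pi.mul_apply] at c1 c2 c3 c4
  have If : Integrable f P := Integrable.of_bound
    (hf.mono h₁ le_rfl).aestronglyMeasurable b (ae_of_all _ hfb)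
  have Ig : Integrable g P := Integrable.of_bound
    (hg.mono h₂ le_rfl).aestronglyMeasurable c (ae_of_all _ hgc)
  have Ifg : Integrable (fun ω => f ω * g ω) P := Ig.bdd_mul
    (hf.mono h₁ le_rfl).aestronglyMeasurable (ae_of_all _ hfb)
  have re_int : ∀ {u : Ω → ℂ}, Integrable u P → (∫ ω, u ω ∂P).re = ∫ ω, (u ω).re ∂P :=
    fun hu => (integral_re (𝕜 := ℂ) hu).symm
  have im_int : ∀ {u : Ω → ℂ}, Integrable u P → (∫ ω, u ω ∂P).im = ∫ ω, (u ω).im ∂P :=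
    fun hu => (integral_im (𝕜 := ℂ) hu).symm
  have I1 := Lfr.integrable_mul Lgr
  have I2 := Lfr.integrable_mul Lgi
  have I3 := Lfi.integrable_mul Lgr
  have I4 := Lfi.integrable_mul Lgi
  refine (Complex.norm_le_abs_re_add_abs_im _).trans ?_
  rw [Complex.sub_re, Complex.sub_im, Complex.mul_re, Complex.mul_im, re_int Ifg, im_int Ifg,
    re_int If, re_int Ig, im_int If, im_int Ig]
  simp_rw [Complex.mul_re, Complex.mul_im]
  have e1 := integral_sub I1 I4
  have e2 := integral_add I2 I3
  simp only [Pi.mul_apply] at e1 e2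
  rw [e1, e2]
  rw [abs_le] at c1 c2 c3 c4
  -- The real and the imaginary part each combine two real covariances, each bounded with constant
  -- 4; this gives 8 twice, and 16 in total.
  have d1 : |((∫ ω, (f ω).re * (g ω).re ∂P) - ∫ ω, (f ω).im * (g ω).im ∂P)
      - ((∫ ω, (f ω).re ∂P) * (∫ ω, (g ω).re ∂P) - (∫ ω, (f ω).im ∂P) * ∫ ω, (g ω).im ∂P)|
      ≤ 8 * (b * c) * a := abs_le.2 ⟨by linarith, by linarith⟩
  have d2 : |((∫ ω, (f ω).re * (g ω).im ∂P) + ∫ ω, (f ω).im * (g ω).re ∂P)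
      - ((∫ ω, (f ω).re ∂P) * (∫ ω, (g ω).im ∂P) + (∫ ω, (f ω).im ∂P) * ∫ ω, (g ω).re ∂P)|
      ≤ 8 * (b * c) * a := abs_le.2 ⟨by linarith, by linarith⟩
  linarith

/-- Nonnegativity of the variances of `f + g` and `f - g`. This additive form replaces
Cauchy–Schwarz wherever both second moments share one bound. -/
lemma abs_cov_le_add_integral_sq {f g : Ω → ℝ} (hf : MemLp f 2 P) (hg : MemLp g 2 P) :
    |cov[f, g; P]| ≤ (∫ ω, f ω ^ 2 ∂P + ∫ ω, g ω ^ 2 ∂P) / 2 := by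
  have h1 := variance_nonneg (f + g) P
  have h2 := variance_nonneg (f - g) P
  rw [variance_add hf hg] at h1
  rw [variance_sub hf hg] at h2
  have h3 := variance_le_expectation_sq hf.aestronglyMeasurable
  have h4 := variance_le_expectation_sq hg.aestronglyMeasurable
  simp only [Pi.pow_apply] at h3 h4
  rw [abs_le]
  constructor <;> linarith

lemma abs_cov_le_integral_mul {f g : Ω → ℝ} (hf : MemLp f 2 P) (hg : MemLp g 2 P) :
    |cov[f, g; P]| ≤ ∫ ω, |f ω| * |g ω| ∂P + (∫ ω, |f ω| ∂P) * ∫ ω, |g ω| ∂P := by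
  rw [covariance_eq_sub hf hg]
  refine (abs_sub _ _).trans ?_
  rw [abs_mul]
  have h1 : |∫ ω, (f * g) ω ∂P| ≤ ∫ ω, |f ω| * |g ω| ∂P := by
    refine (abs_integral_le_integral_abs).trans_eq ?_
    simp [abs_mul]
  have h2 : |∫ ω, f ω ∂P| ≤ ∫ ω, |f ω| ∂P := abs_integral_le_integral_abs
  have h3 : |∫ ω, g ω ∂P| ≤ ∫ ω, |g ω| ∂P := abs_integral_le_integral_abs
  gcongr

/-- Truncation of a real number at level `A`. -/
noncomputable def cut (A x : ℝ) : ℝ := if |x| ≤ A then x else 0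

lemma measurable_cut (A : ℝ) : Measurable (cut A) :=
  Measurable.ite (measurableSet_le measurable_norm measurable_const) measurable_id measurable_const

lemma abs_cut_le {A : ℝ} (hA : 0 ≤ A) (x : ℝ) : |cut A x| ≤ A := by
  unfold cut; split_ifs with h <;> simp [h, hA]

lemma abs_cut_le_abs (A x : ℝ) : |cut A x| ≤ |x| := by
  unfold cut; split_ifs <;> simp

lemma abs_sub_cut_le_abs (A x : ℝ) : |x - cut A x| ≤ |x| := by
  unfold cut; split_ifs <;> simp

/-- Markov's inequality in pointwise form: where the difference is nonzero, `|x| > A`, and the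
exponent `s - p` is nonpositive. -/
lemma abs_sub_cut_rpow_le {A x p s : ℝ} (hA : 0 < A) (hs : 0 < s) (hsp : s ≤ p) :
    |x - cut A x| ^ s ≤ A ^ (s - p) * |x| ^ p := by
  unfold cut
  split_ifs with h
  · rw [sub_self, abs_zero, Real.zero_rpow hs.ne']; positivity
  · have hx : A < |x| := not_le.1 h
    have hx0 : 0 < |x| := hA.trans hx
    rw [sub_zero]
    calc |x| ^ s = |x| ^ (s - p) * |x| ^ p := by rw [← Real.rpow_add hx0]; congr 1; ring
      _ ≤ _ := by
        gcongr ?_ * _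
        exact Real.rpow_le_rpow_of_nonpos hA hx.le (by linarith)

/-- Davydov's covariance inequality. -/
theorem AlphaLE.abs_cov_le_rpow {a : ℝ} (h : AlphaLE P m₁ m₂ a)
    (ha : 0 < a) (h₁ : m₁ ≤ mΩ) (h₂ : m₂ ≤ mΩ) {f g : Ω → ℝ} {p η : ℝ} (hp : 2 < p) (hη : 0 < η)
    (hf : Measurable[m₁] f) (hg : Measurable[m₂] g)
    (hfp : Integrable (fun ω => |f ω| ^ p) P) (hgp : Integrable (fun ω => |g ω| ^ p) P)
    (hfη : ∫ ω, |f ω| ^ p ∂P ≤ η) (hgη : ∫ ω, |g ω| ^ p ∂P ≤ η) :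
    |cov[f, g; P]| ≤ 9 * a ^ (1 - 2 / p) * η ^ (2 / p) := by
  -- This truncation level balances the bounded part, of order `a A²`, against the tail part, of
  -- order `A^(2-p) η`; both become `a^(1-2/p) η^(2/p)`.
  set A : ℝ := (η / a) ^ (1 / p) with hA
  have hp0 : 0 < p := by linarith
  have hA0 : 0 < A := by positivity
  have eA2 : a * A ^ (2 : ℝ) = a ^ (1 - 2 / p) * η ^ (2 / p) := by
    rw [hA, ← Real.rpow_mul (by positivity), Real.div_rpow hη.le ha.le, Real.rpow_sub ha,
      Real.rpow_one]
    rw [show 1 / p * 2 = 2 / p by ring]; ring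
  have eAp : A ^ (2 - p) * η = a ^ (1 - 2 / p) * η ^ (2 / p) := by
    rw [← eA2, Real.rpow_sub hA0, hA, ← Real.rpow_mul (by positivity) _ p,
      one_div_mul_cancel hp0.ne', Real.rpow_one]
    field_simp
  -- facts about one of the two variables
  have key : ∀ {u : Ω → ℝ}, Measurable u → Integrable (fun ω => |u ω| ^ p) P →
      ∫ ω, |u ω| ^ p ∂P ≤ η →
      MemLp (fun ω => u ω - cut A (u ω)) 2 P ∧
      ∫ ω, (u ω - cut A (u ω)) ^ 2 ∂P ≤ A ^ (2 - p) * η ∧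
      A * ∫ ω, |u ω - cut A (u ω)| ∂P ≤ A ^ (2 - p) * η := by
    intro u hum hup huη
    have hcm : Measurable fun ω => u ω - cut A (u ω) := hum.sub ((measurable_cut A).comp hum)
    have b2 : ∀ ω, (u ω - cut A (u ω)) ^ 2 ≤ A ^ (2 - p) * |u ω| ^ p := fun ω => by
      have := abs_sub_cut_rpow_le (x := u ω) hA0 (zero_lt_two) hp.le
      rwa [Real.rpow_two, sq_abs] at this
    have i2 : Integrable (fun ω => (u ω - cut A (u ω)) ^ 2) P :=
      (hup.const_mul _).mono' (hcm.pow_const 2).aestronglyMeasurable (ae_of_all _ fun ω => by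
        rw [Real.norm_of_nonneg (sq_nonneg _)]; exact b2 ω)
    have l2 : MemLp (fun ω => u ω - cut A (u ω)) 2 P :=
      (memLp_two_iff_integrable_sq hcm.aestronglyMeasurable).2 i2
    refine ⟨l2, ?_, ?_⟩
    · calc _ ≤ ∫ ω, A ^ (2 - p) * |u ω| ^ p ∂P := integral_mono i2 (hup.const_mul _) b2
        _ ≤ _ := by rw [integral_const_mul]; gcongr
    · rw [← integral_const_mul]
      calc _ ≤ ∫ ω, A ^ (2 - p) * |u ω| ^ p ∂P := by
            refine integral_mono ((l2.integrable (by norm_num)).abs.const_mul _)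
              (hup.const_mul _) fun ω => ?_
            have := abs_sub_cut_rpow_le (x := u ω) hA0 zero_lt_one (by linarith : (1 : ℝ) ≤ p)
            rw [Real.rpow_one] at this
            calc A * |u ω - cut A (u ω)| ≤ A * (A ^ (1 - p) * |u ω| ^ p) := by gcongr
              _ = _ := by
                rw [← mul_assoc, show 2 - p = 1 + (1 - p) by ring, Real.rpow_add hA0,
                  Real.rpow_one]
        _ ≤ _ := by rw [integral_const_mul]; gcongr
  obtain ⟨Lf, f2, f1⟩ := key (hf.mono h₁ le_rfl) hfp hfη
  obtain ⟨Lg, g2, g1⟩ := key (hg.mono h₂ le_rfl) hgp hgη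
  have cf : Measurable[m₁] fun ω => cut A (f ω) := (measurable_cut A).comp hf
  have cg : Measurable[m₂] fun ω => cut A (g ω) := (measurable_cut A).comp hg
  have Lcf : MemLp (fun ω => cut A (f ω)) 2 P :=
    memLp_of_abs_le (cf.mono h₁ le_rfl) (fun ω => abs_cut_le hA0.le _) 2
  have Lcg : MemLp (fun ω => cut A (g ω)) 2 P :=
    memLp_of_abs_le (cg.mono h₂ le_rfl) (fun ω => abs_cut_le hA0.le _) 2
  have k1 := h.abs_cov_le h₁ h₂ cf cg (fun ω => abs_cut_le hA0.le _) (fun ω => abs_cut_le hA0.le _)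
  have k4 := abs_cov_le_add_integral_sq Lf Lg
  -- the mixed terms
  have mixed : ∀ {u v : Ω → ℝ}, MemLp u 2 P → (∀ ω, |u ω| ≤ A) → MemLp v 2 P →
      A * ∫ ω, |v ω| ∂P ≤ A ^ (2 - p) * η → |cov[u, v; P]| ≤ 2 * (A ^ (2 - p) * η) := by
    intro u v hu huA hv hvA
    refine (abs_cov_le_integral_mul hu hv).trans ?_
    have iv := (hv.integrable one_le_two).abs
    have e1 : ∫ ω, |u ω| * |v ω| ∂P ≤ A * ∫ ω, |v ω| ∂P := by
      rw [← integral_const_mul]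
      refine integral_mono_of_nonneg (ae_of_all _ fun ω => by positivity) (iv.const_mul _)
        (ae_of_all _ fun ω => mul_le_mul_of_nonneg_right (huA ω) (abs_nonneg _))
    have e2 : ∫ ω, |u ω| ∂P ≤ A := by
      calc _ ≤ ∫ _, A ∂P := integral_mono (hu.integrable one_le_two).abs (integrable_const _) huA
        _ = A := by simp
    have e3 : (∫ ω, |u ω| ∂P) * ∫ ω, |v ω| ∂P ≤ A * ∫ ω, |v ω| ∂P :=
      mul_le_mul_of_nonneg_right e2 (integral_nonneg fun _ => abs_nonneg _)
    linarith
  have k2 := mixed Lcf (fun ω => abs_cut_le hA0.le _) Lg g1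
  have k3 := mixed Lcg (fun ω => abs_cut_le hA0.le _) Lf f1
  rw [covariance_comm] at k3
  have split : cov[f, g; P] = cov[fun ω => cut A (f ω), fun ω => cut A (g ω); P]
      + cov[fun ω => cut A (f ω), fun ω => g ω - cut A (g ω); P]
      + cov[fun ω => f ω - cut A (f ω), fun ω => cut A (g ω); P]
      + cov[fun ω => f ω - cut A (f ω), fun ω => g ω - cut A (g ω); P] := by
    have ef : f = (fun ω => cut A (f ω)) + fun ω => f ω - cut A (f ω) := by ext; simp
    have eg : g = (fun ω => cut A (g ω)) + fun ω => g ω - cut A (g ω) := by ext; simp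
    conv_lhs => rw [ef, eg]
    rw [covariance_add_left Lcf Lf (Lcg.add Lg), covariance_add_right Lcf Lcg Lg,
      covariance_add_right Lf Lcg Lg]
    ring
  have hAA : 4 * (A * A) * a = 4 * (a * A ^ (2 : ℝ)) := by rw [Real.rpow_two]; ring
  rw [hAA, eA2] at k1
  rw [eAp] at k2 k3 f2 g2
  -- The constant is 9 = 4 + 2 + 2 + 1: the truncated pair, the two mixed covariances, and the pair
  -- of tails.
  rw [split, mul_assoc]
  refine (abs_add_le _ _).trans ?_
  have t1 := abs_add_le (cov[fun ω => cut A (f ω), fun ω => cut A (g ω); P])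
    (cov[fun ω => cut A (f ω), fun ω => g ω - cut A (g ω); P])
  have t2 := abs_add_le (cov[fun ω => cut A (f ω), fun ω => cut A (g ω); P]
    + cov[fun ω => cut A (f ω), fun ω => g ω - cut A (g ω); P])
    (cov[fun ω => f ω - cut A (f ω), fun ω => cut A (g ω); P])
  linarith

end CovarianceInequalities

/-! ### Second moments of sums with decaying correlations -/

section SumOfSquares

variable {Ω : Type*} {mΩ : MeasurableSpace Ω} {P : Measure Ω}

/-- With truncated subtraction, `(j - i) + (i - j)` is `|i - j|`. Each distance is attained at most
once on either side of `i`, whence the factor 2. -/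
lemma sum_dist_le {n : ℕ} {I : Finset ℕ} (hI : I ⊆ Finset.range n) {v : ℕ → ℝ} (hv : ∀ k, 0 ≤ v k)
    {i : ℕ} (hi : i < n) :
    ∑ j ∈ I, v ((j - i) + (i - j)) ≤ 2 * ∑ k ∈ Finset.range n, v k := by
  rw [← Finset.sum_filter_add_sum_filter_not I (fun j => i ≤ j), two_mul]
  have hlt : ∀ j ∈ I, j < n := fun j hj => Finset.mem_range.1 (hI hj)
  have key : ∀ J : Finset ℕ, J ⊆ I → ∀ d : ℕ → ℕ, Set.InjOn d J → (∀ j ∈ J, d j < n) →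
      ∑ j ∈ J, v (d j) ≤ ∑ k ∈ Finset.range n, v k := by
    intro J hJ d hd hdn
    rw [← Finset.sum_image hd]
    refine Finset.sum_le_sum_of_subset_of_nonneg ?_ fun k _ _ => hv k
    intro k hk
    obtain ⟨j, hj, rfl⟩ := Finset.mem_image.1 hk
    exact Finset.mem_range.2 (hdn j hj)
  refine add_le_add (key _ (Finset.filter_subset _ _) _ ?_ ?_)
    (key _ (Finset.filter_subset _ _) _ ?_ ?_)
  · intro a ha b hb hab
    simp only [Finset.coe_filter, Set.mem_ofPred_eq] at ha hb hab
    omega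
  · intro j hj
    have := hlt j (Finset.mem_filter.1 hj).1
    have := (Finset.mem_filter.1 hj).2
    omega
  · intro a ha b hb hab
    simp only [Finset.coe_filter, Set.mem_ofPred_eq] at ha hb hab
    omega
  · intro j hj
    have := hlt j (Finset.mem_filter.1 hj).1
    have := (Finset.mem_filter.1 hj).2
    omega

/-- The second moment of a sum whose terms have mixed moments bounded in terms of the distance of
the indices. -/
lemma integral_sum_sq_le {n : ℕ} {I : Finset ℕ} (hI : I ⊆ Finset.range n) {v : ℕ → ℝ}
    (hv : ∀ k, 0 ≤ v k) {W : ℕ → Ω → ℝ} (hW : ∀ i, MemLp (W i) 2 P)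
    (h : ∀ i k, i + k < n → |∫ ω, W i ω * W (i + k) ω ∂P| ≤ v k) :
    ∫ ω, (∑ i ∈ I, W i ω) ^ 2 ∂P ≤ I.card * (2 * ∑ k ∈ Finset.range n, v k) := by
  have hij : ∀ i j, Integrable (fun ω => W i ω * W j ω) P := fun i j => (hW i).integrable_mul (hW j)
  have hlt : ∀ j ∈ I, j < n := fun j hj => Finset.mem_range.1 (hI hj)
  simp_rw [sq, Finset.sum_mul_sum]
  rw [integral_finsetSum _ fun i _ => integrable_finsetSum _ fun j _ => hij i j]
  rw [← nsmul_eq_mul]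
  refine Finset.sum_le_card_nsmul _ _ _ fun i hi => ?_
  rw [integral_finsetSum _ fun j _ => hij i j]
  refine le_trans (Finset.sum_le_sum fun j hj => ?_) (sum_dist_le hI hv (hlt i hi))
  refine (le_abs_self _).trans ?_
  rcases le_total i j with hle | hle
  · obtain ⟨k, rfl⟩ := Nat.exists_eq_add_of_le hle
    rw [show i + k - i + (i - (i + k)) = k by omega]
    exact h i k (hlt _ hj)
  · obtain ⟨k, rfl⟩ := Nat.exists_eq_add_of_le hle
    rw [show j - (j + k) + (j + k - j) = k by omega]
    simp_rw [mul_comm (W (j + k) _)]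
    exact h j k (hlt _ hi)

lemma integral_abs_le_sqrt [IsProbabilityMeasure P] {f : Ω → ℝ} (hf : MemLp f 2 P) :
    ∫ ω, |f ω| ∂P ≤ √(∫ ω, f ω ^ 2 ∂P) := by
  refine Real.le_sqrt_of_sq_le ?_
  have h := variance_nonneg (fun ω => |f ω|) P
  have h' : MemLp (fun ω => |f ω|) 2 P := hf.abs
  rw [variance_eq_sub h'] at h
  simp only [Pi.pow_apply, sq_abs] at h
  linarith

end SumOfSquares

/-! ### Taylor remainder, near-Gaussian differential equation, summable antitone sequences -/

section Calculus

/-- Mean value inequality: the derivative at `y` has norm `|e^{iy} - 1| ≤ |y| ≤ |x|`. The sharp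
constant 1/2 is not needed. -/
lemma norm_exp_I_mul_sub_le (x : ℝ) :
    ‖Complex.exp (x * Complex.I) - 1 - x * Complex.I‖ ≤ x ^ 2 := by
  have hd : ∀ y : ℝ, HasDerivAt
      (fun y : ℝ => Complex.exp (y * Complex.I) - 1 - y * Complex.I)
      ((Complex.exp (Complex.I * y) - 1) * Complex.I) y := by
    intro y
    have h1 : HasDerivAt (fun y : ℝ => (y : ℂ) * Complex.I) (1 * Complex.I) y :=
      (Complex.ofRealCLM.hasDerivAt (x := y)).mul_const _
    convert! (h1.cexp.sub_const 1).sub h1 using 1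
    rw [mul_comm Complex.I]; ring
  have h := (convex_Icc (-|x|) |x|).norm_image_sub_le_of_norm_hasDerivWithin_le
    (C := |x|) (fun y _ => (hd y).hasDerivWithinAt) (fun y hy => ?_)
    (x := 0) (y := x) ⟨by simp, abs_nonneg x⟩ ⟨neg_abs_le x, le_abs_self x⟩
  · simpa [← sq] using h
  · rw [norm_mul, Complex.norm_I, mul_one]
    exact Real.norm_exp_I_mul_ofReal_sub_one_le.trans (abs_le.2 hy)

/-- A function that almost solves `φ' = -s t φ` is almost Gaussian. -/
lemma norm_sub_exp_le_of_deriv {φ φ' : ℝ → ℂ} {s η t : ℝ} (h0 : φ 0 = 1)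
    (hd : ∀ x, HasDerivAt φ (φ' x) x)
    (hb : ∀ x, |x| ≤ |t| → ‖φ' x + x * s * φ x‖ ≤ η) :
    ‖φ t - Complex.exp (-(s * t ^ 2 / 2))‖ ≤ η * (Real.exp (|s| * t ^ 2) * |t|) := by
  have hη : 0 ≤ η := (norm_nonneg _).trans (hb t le_rfl)
  have hE : ∀ x : ℝ, HasDerivAt (fun x : ℝ => Complex.exp (s * x ^ 2 / 2))
      (Complex.exp (s * x ^ 2 / 2) * (s * x)) x := by
    intro x
    have h1 : HasDerivAt (fun x : ℝ => (x : ℂ)) 1 x := Complex.ofRealCLM.hasDerivAt (x := x)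
    convert! (((h1.pow 2).const_mul (s : ℂ)).div_const 2).cexp using 1
    simp only [Nat.cast_ofNat, Nat.add_one_sub_one, pow_one, mul_one, Pi.pow_apply]
    ring
  -- Integrating factor: multiplied by `e^{s x²/2}`, the defect `φ' + s x φ` becomes an exact
  -- derivative.
  have hg : ∀ x : ℝ, HasDerivAt (fun x : ℝ => Complex.exp (s * x ^ 2 / 2) * φ x)
      (Complex.exp (s * x ^ 2 / 2) * (φ' x + x * s * φ x)) x := by
    intro x
    convert! (hE x).mul (hd x) using 1
    ring
  have nE : ∀ x : ℝ, ‖Complex.exp (s * x ^ 2 / 2)‖ = Real.exp (s * x ^ 2 / 2) := by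
    intro x
    rw [Complex.norm_exp]
    congr 1
    rw [show (s : ℂ) * x ^ 2 / 2 = ((s * x ^ 2 / 2 : ℝ) : ℂ) by push_cast; ring, Complex.ofReal_re]
  have hC : ∀ x, |x| ≤ |t| → Real.exp (s * x ^ 2 / 2) ≤ Real.exp (|s| * t ^ 2 / 2) := by
    intro x hx
    have h1 : x ^ 2 ≤ t ^ 2 := sq_le_sq.2 hx
    have h2 : s * x ^ 2 ≤ |s| * t ^ 2 :=
      (mul_le_mul_of_nonneg_right (le_abs_self s) (sq_nonneg x)).trans (by gcongr)
    gcongr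
  have h := (convex_Icc (-|t|) |t|).norm_image_sub_le_of_norm_hasDerivWithin_le
    (C := Real.exp (|s| * t ^ 2 / 2) * η) (fun y _ => (hg y).hasDerivWithinAt) (fun y hy => ?_)
    (x := 0) (y := t) ⟨by simp, abs_nonneg t⟩ ⟨neg_abs_le t, le_abs_self t⟩
  · simp only [h0, mul_one, sub_zero, Real.norm_eq_abs] at h
    have e : φ t - Complex.exp (-(s * t ^ 2 / 2)) = Complex.exp (-(s * t ^ 2 / 2)) *
        (Complex.exp (s * t ^ 2 / 2) * φ t - Complex.exp (s * (0 : ℝ) ^ 2 / 2)) := by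
      rw [mul_sub, ← mul_assoc, ← Complex.exp_add]
      simp
    have n2 : ‖Complex.exp (-(s * t ^ 2 / 2))‖ ≤ Real.exp (|s| * t ^ 2 / 2) := by
      rw [show (-(s * t ^ 2 / 2) : ℂ) = (((-s) : ℝ) : ℂ) * t ^ 2 / 2 by push_cast; ring,
        Complex.norm_exp,
        show (((-s) : ℝ) : ℂ) * t ^ 2 / 2 = (((-s) * t ^ 2 / 2 : ℝ) : ℂ) by push_cast; ring,
        Complex.ofReal_re]
      gcongr
      exact neg_le_abs s
    rw [e, norm_mul]
    calc _ ≤ Real.exp (|s| * t ^ 2 / 2) * (Real.exp (|s| * t ^ 2 / 2) * η * |t|) := by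
          gcongr
      _ = _ := by
          rw [← add_halves (|s| * t ^ 2), Real.exp_add, add_halves]; ring
  · have hy' : |y| ≤ |t| := abs_le.2 hy
    rw [norm_mul, nE]
    exact mul_le_mul (hC y hy') (hb y hy') (norm_nonneg _) (Real.exp_nonneg _)

/-- At least `n/2` terms with index from `n/2` to `n` are each no smaller than `a n`, so `n a n` is
at most twice the tail of the series from `n/2`. -/
lemma tendsto_mul_of_antitone_summable {a : ℕ → ℝ} (ha : Antitone a) (hs : Summable a) :
    Tendsto (fun n : ℕ => (n : ℝ) * a n) atTop (𝓝 0) := by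
  have h0 : ∀ n, 0 ≤ a n := fun n => ha.le_of_tendsto hs.tendsto_atTop_zero n
  have hhalf : Tendsto (fun n : ℕ => n / 2) atTop atTop :=
    Nat.tendsto_div_const_atTop (by norm_num)
  have hT := ((tendsto_sum_nat_add a).comp hhalf).const_mul 2
  rw [mul_zero] at hT
  refine squeeze_zero (fun n => mul_nonneg n.cast_nonneg (h0 n)) (fun n => ?_) hT
  have hs' : Summable fun k => a (k + n / 2) := (summable_nat_add_iff _).2 hs
  have h1 := hs'.sum_le_tsum (Finset.range (n - n / 2)) fun k _ => h0 _
  have h2 := Finset.card_nsmul_le_sum (Finset.range (n - n / 2)) (fun k => a (k + n / 2)) (a n)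
    fun k hk => ha (by have := Finset.mem_range.1 hk; omega)
  rw [Finset.card_range, nsmul_eq_mul] at h2
  have h3 : (n : ℝ) ≤ 2 * (n - n / 2 : ℕ) := by exact_mod_cast (by omega : n ≤ 2 * (n - n / 2))
  have h4 := mul_le_mul_of_nonneg_right h3 (h0 n)
  simp only [Function.comp_apply]
  linarith

end Calculus

/-! ### Bounded mixing sequences: windows and decoupling -/

section BoundedMixing

variable {Ω : Type*} [MeasurableSpace Ω] {P : Measure Ω} {Y : ℕ → Ω → ℝ} {B : ℝ} {a r : ℕ → ℝ}

omit [MeasurableSpace Ω] in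
lemma measurable_past (Y : ℕ → Ω → ℝ) {i k : ℕ} (h : i ≤ k) : Measurable[past Y k] (Y i) :=
  (comap_measurable (Y i)).mono (le_iSup₂_of_le i h le_rfl) le_rfl

omit [MeasurableSpace Ω] in
lemma measurable_future (Y : ℕ → Ω → ℝ) {i k : ℕ} (h : k ≤ i) : Measurable[future Y k] (Y i) :=
  (comap_measurable (Y i)).mono (le_iSup₂_of_le i h le_rfl) le_rfl

lemma past_le (hY : ∀ i, Measurable (Y i)) (k : ℕ) : past Y k ≤ ‹MeasurableSpace Ω› :=
  iSup₂_le fun i _ => (hY i).comap_le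

lemma future_le (hY : ∀ i, Measurable (Y i)) (k : ℕ) : future Y k ≤ ‹MeasurableSpace Ω› :=
  iSup₂_le fun i _ => (hY i).comap_le

/-- A bounded centred sequence with stationary covariances `r` and summable alpha-mixing
coefficients `a`. -/
structure BoundedMixing (Y : ℕ → Ω → ℝ) (P : Measure Ω) (B : ℝ) (a r : ℕ → ℝ) : Prop where
  meas : ∀ i, Measurable (Y i)
  bound : ∀ i ω, |Y i ω| ≤ B
  mean : ∀ i, ∫ ω, Y i ω ∂P = 0
  cov : ∀ i k, ∫ ω, Y i ω * Y (i + k) ω ∂P = r k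
  mix : ∀ i k, AlphaLE P (past Y i) (future Y (i + k)) (a k)
  anti : Antitone a
  summ : Summable a

/-- The indices below `n` at distance at most `m` from `j`. -/
def window (n m j : ℕ) : Finset ℕ := Finset.Ico (j - m) (min n (j + m + 1))

lemma card_window_le (n m j : ℕ) : (window n m j).card ≤ 2 * m + 1 := by
  rw [window, Nat.card_Ico]; omega

lemma sum_range_eq_window {n m j : ℕ} (hj : j < n) (f : ℕ → ℝ) :
    ∑ i ∈ Finset.range n, f i = ∑ i ∈ Finset.range (j - m), f i + ∑ i ∈ window n m j, f i
      + ∑ i ∈ Finset.Ico (j + m + 1) n, f i := by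
  rw [window, Finset.range_eq_Ico, Finset.range_eq_Ico,
    Finset.sum_Ico_consecutive f (Nat.zero_le _) (by omega)]
  rcases le_total n (j + m + 1) with h | h
  · rw [min_eq_left h, Finset.Ico_eq_empty_of_le h, Finset.sum_empty, add_zero]
  · rw [min_eq_right h, Finset.sum_Ico_consecutive f (Nat.zero_le _) h]

/-- The sum of the variables in the window about `j`. -/
def windowSum (Y : ℕ → Ω → ℝ) (n m j : ℕ) (ω : Ω) : ℝ := ∑ i ∈ window n m j, Y i ω

/-- The sum of the variables with index below `n` outside of the window about `j`. -/
def outerSum (Y : ℕ → Ω → ℝ) (n m j : ℕ) (ω : Ω) : ℝ :=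
  ∑ i ∈ Finset.range (j - m), Y i ω + ∑ i ∈ Finset.Ico (j + m + 1) n, Y i ω

omit [MeasurableSpace Ω] in
lemma sum_range_eq_outerSum_add {n m j : ℕ} (hj : j < n) (ω : Ω) :
    ∑ i ∈ Finset.range n, Y i ω = outerSum Y n m j ω + windowSum Y n m j ω := by
  rw [sum_range_eq_window (m := m) hj, outerSum, windowSum]; ring

namespace BoundedMixing

variable (h : BoundedMixing Y P B a r)
include h

lemma measurable_windowSum (n m j : ℕ) : Measurable (windowSum Y n m j) :=
  Finset.measurable_fun_sum _ fun i _ => h.meas i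

lemma measurable_outerSum (n m j : ℕ) : Measurable (outerSum Y n m j) :=
  (Finset.measurable_fun_sum _ fun i _ => h.meas i).add
    (Finset.measurable_fun_sum _ fun i _ => h.meas i)

lemma abs_windowSum_le [IsProbabilityMeasure P] (n m j : ℕ) (ω : Ω) :
    |windowSum Y n m j ω| ≤ (2 * m + 1) * B := by
  have hB : 0 ≤ B := nonneg_of_forall_abs_le P (h.bound 0)
  refine (Finset.abs_sum_le_sum_abs _ _).trans ?_
  refine (Finset.sum_le_card_nsmul _ _ B fun i _ => h.bound i ω).trans ?_
  rw [nsmul_eq_mul]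
  gcongr
  exact_mod_cast card_window_le n m j

lemma memLp [IsProbabilityMeasure P] (i : ℕ) : MemLp (Y i) 2 P :=
  memLp_of_abs_le (h.meas i) (h.bound i) 2

lemma a_nonneg (k : ℕ) : 0 ≤ a k := (h.mix 0 k).nonneg

lemma abs_r_le [IsProbabilityMeasure P] (k : ℕ) : |r k| ≤ 4 * (B * B) * a k := by
  have := (h.mix 0 k).abs_cov_le (past_le h.meas _) (future_le h.meas _)
    (measurable_past Y le_rfl) (measurable_future Y le_rfl) (h.bound _) (h.bound _)
  rw [covariance_eq_sub (h.memLp _) (h.memLp _), h.mean, h.mean] at this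
  simp only [Pi.mul_apply] at this
  rw [h.cov] at this
  simpa using this

lemma summable_abs_r [IsProbabilityMeasure P] : Summable fun k => |r k| :=
  (h.summ.mul_left (4 * (B * B))).of_nonneg_of_le (fun _ => abs_nonneg _) h.abs_r_le

lemma integral_sum_sq_le [IsProbabilityMeasure P] (I : Finset ℕ) :
    ∫ ω, (∑ i ∈ I, Y i ω) ^ 2 ∂P ≤ I.card * (2 * ∑' k, |r k|) := by
  refine (TimeSeries.integral_sum_sq_le (n := I.sup id + 1) (v := fun k => |r k|) ?_ ?_ ?_ ?_).trans
    ?_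
  · intro i hi
    exact Finset.mem_range.2 (Nat.lt_succ_of_le (Finset.le_sup (f := id) hi))
  · exact fun _ => abs_nonneg _
  · exact h.memLp
  · intro i k _
    rw [h.cov]
  · gcongr
    exact h.summable_abs_r.sum_le_tsum _ fun _ _ => abs_nonneg _

lemma integral_windowSum_sq_le [IsProbabilityMeasure P] (n m j : ℕ) :
    ∫ ω, windowSum Y n m j ω ^ 2 ∂P ≤ (2 * m + 1) * (2 * ∑' k, |r k|) := by
  refine (h.integral_sum_sq_le _).trans ?_
  have : (0 : ℝ) ≤ ∑' k, |r k| := tsum_nonneg fun _ => abs_nonneg _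
  gcongr
  exact_mod_cast card_window_le n m j

/-- A variable is almost uncorrelated with functions of the variables outside of a window. -/
lemma norm_integral_mul_exp_outerSum_le [IsProbabilityMeasure P] (n m j : ℕ) (s : ℝ) :
    ‖∫ ω, (Y j ω : ℂ) * Complex.exp ((s * outerSum Y n m j ω : ℝ) * Complex.I) ∂P‖
      ≤ 32 * B * a (m + 1) := by
  have hB : 0 ≤ B := nonneg_of_forall_abs_le P (h.bound 0)
  have ha := h.a_nonneg (m + 1)
  have hmexp : ∀ {n : MeasurableSpace Ω} {g : Ω → ℝ}, Measurable[n] g →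
      Measurable[n] fun ω => Complex.exp ((s * g ω : ℝ) * Complex.I) := fun hg => by
    have : Measurable fun x : ℝ => Complex.exp ((s * x : ℝ) * Complex.I) := by fun_prop
    exact this.comp hg
  set U : Ω → ℂ := fun ω =>
    Complex.exp ((s * ∑ i ∈ Finset.range (j - m), Y i ω : ℝ) * Complex.I) with hU
  set V : Ω → ℂ := fun ω =>
    Complex.exp ((s * ∑ i ∈ Finset.Ico (j + m + 1) n, Y i ω : ℝ) * Complex.I) with hV
  have nU : ∀ ω, ‖U ω‖ ≤ 1 := fun ω => (Complex.norm_exp_ofReal_mul_I _).le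
  have nV : ∀ ω, ‖V ω‖ ≤ 1 := fun ω => (Complex.norm_exp_ofReal_mul_I _).le
  have nY : ∀ ω, ‖(Y j ω : ℂ)‖ ≤ B := fun ω => by simpa using h.bound j ω
  have mU : ∀ k, j ≤ k + m + 1 → Measurable[past Y k] U := fun k hk => hmexp
    (Finset.measurable_fun_sum _ fun i hi => measurable_past Y (by
      have := Finset.mem_range.1 hi; omega))
  have mV : Measurable[future Y (j + (m + 1))] V := hmexp
    (Finset.measurable_fun_sum _ fun i hi => measurable_future Y (by
      have := Finset.mem_Ico.1 hi; omega))
  have e1 : ∀ ω, (Y j ω : ℂ) * Complex.exp ((s * outerSum Y n m j ω : ℝ) * Complex.I)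
      = (Y j ω * U ω) * V ω := fun ω => by
    rw [hU, hV, mul_assoc, ← Complex.exp_add, outerSum]
    congr 2
    push_cast; ring
  simp_rw [e1]
  -- The variables right of the window are split off first, with `Y j` kept among the past; `h2`
  -- then separates `Y j` from those to the left. Each separation costs `16 B a(m+1)`.
  have h1 := (h.mix j (m + 1)).norm_integral_mul_sub_le (past_le h.meas _) (future_le h.meas _)
    (f := fun ω => (Y j ω : ℂ) * U ω) (g := V) (b := B) (c := 1)
    ((Complex.measurable_ofReal.comp (measurable_past Y le_rfl)).mul (mU j (by omega))) mV
    (fun ω => by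
      rw [norm_mul, ← mul_one B]
      exact mul_le_mul (nY ω) (nU ω) (norm_nonneg _) hB) nV
  have h2 : ‖∫ ω, (Y j ω : ℂ) * U ω ∂P‖ ≤ 16 * B * a (m + 1) := by
    have h0 : ∫ ω, (Y j ω : ℂ) ∂P = 0 := by
      rw [integral_complex_ofReal, h.mean]; simp
    -- If `j ≤ m`, nothing lies to the left of the window, so `U = 1` and the integral vanishes
    -- because `Y j` is centred.
    rcases le_or_gt (m + 1) j with hj | hj
    · have h3 := (h.mix (j - (m + 1)) (m + 1)).norm_integral_mul_sub_le (past_le h.meas _)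
        (future_le h.meas _) (f := U) (g := fun ω => (Y j ω : ℂ)) (b := 1) (c := B)
        (mU _ (by omega)) (Complex.measurable_ofReal.comp (measurable_future Y (by omega))) nU nY
      rw [h0, mul_zero, sub_zero, one_mul] at h3
      simpa only [mul_comm] using h3
    · have : ∀ ω, U ω = 1 := fun ω => by
        have : j - m = 0 := by omega
        simp [hU, this]
      simp_rw [this, mul_one, h0, norm_zero]
      positivity
  have h3 : ‖∫ ω, V ω ∂P‖ ≤ 1 := by
    simpa using norm_integral_le_of_norm_le_const (μ := P) (ae_of_all _ nV)
  have h4 : ‖(∫ ω, (Y j ω : ℂ) * U ω ∂P) * ∫ ω, V ω ∂P‖ ≤ 16 * B * a (m + 1) := by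
    rw [norm_mul, ← mul_one (16 * B * a (m + 1))]
    exact mul_le_mul h2 h3 (norm_nonneg _) (by positivity)
  have h5 := norm_add_le (∫ ω, (Y j ω : ℂ) * U ω * V ω ∂P
    - (∫ ω, (Y j ω : ℂ) * U ω ∂P) * ∫ ω, V ω ∂P) ((∫ ω, (Y j ω : ℂ) * U ω ∂P) * ∫ ω, V ω ∂P)
  rw [sub_add_cancel] at h5
  linarith

/-- Fluctuation of the sum of the products of the variables with the sums over their windows. -/
lemma integral_sum_mul_windowSum_sq_le [IsProbabilityMeasure P] (n m : ℕ) :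
    ∫ ω, (∑ j ∈ Finset.range n, (Y j ω * windowSum Y n m j ω
        - ∫ ω', Y j ω' * windowSum Y n m j ω' ∂P)) ^ 2 ∂P
      ≤ n * (2 * m + 1) ^ 2 * (2 * (B ^ 2 * (2 * ∑' k, |r k|) + 4 * B ^ 4 * ∑' k, a k)) := by
  have hB : 0 ≤ B := nonneg_of_forall_abs_le P (h.bound 0)
  set K : ℝ := 2 * ∑' k, |r k| with hK
  have hK0 : 0 ≤ K := mul_nonneg zero_le_two (tsum_nonneg fun _ => abs_nonneg _)
  set M : ℝ := 2 * m + 1 with hM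
  have hM0 : 0 ≤ M := by positivity
  set U : ℕ → Ω → ℝ := fun j ω => Y j ω * windowSum Y n m j ω with hU
  have mU : ∀ j, Measurable (U j) := fun j => (h.meas j).mul (h.measurable_windowSum n m j)
  have bU : ∀ j ω, |U j ω| ≤ M * B ^ 2 := fun j ω => by
    rw [hU, abs_mul]
    calc _ ≤ B * (M * B) :=
          mul_le_mul (h.bound j ω) (h.abs_windowSum_le n m j ω) (abs_nonneg _) hB
      _ = _ := by ring
  have LU : ∀ j, MemLp (U j) 2 P := fun j => memLp_of_abs_le (mU j) (bU j) 2
  have sqU : ∀ j, ∫ ω, U j ω ^ 2 ∂P ≤ B ^ 2 * (M * K) := fun j => by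
    calc ∫ ω, U j ω ^ 2 ∂P ≤ ∫ ω, B ^ 2 * windowSum Y n m j ω ^ 2 ∂P := by
          refine integral_mono (LU j).integrable_sq (Integrable.const_mul (MemLp.integrable_sq
            (memLp_of_abs_le (h.measurable_windowSum n m j) (h.abs_windowSum_le n m j) 2)) _)
            fun ω => ?_
          simp only [hU, mul_pow]
          gcongr ?_ * _
          exact sq_le_sq' (abs_le.1 (h.bound j ω)).1 (abs_le.1 (h.bound j ω)).2
      _ ≤ _ := by
          rw [integral_const_mul]
          gcongr
          exact h.integral_windowSum_sq_le n m j
  -- At distance `d ≤ 2m` the windows may meet and second moments are used. Beyond that they are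
  -- separated by a gap `d - 2m`, and mixing applies to products bounded by `M B²`. Both regimes sum
  -- to order `M²`.
  set v : ℕ → ℝ := fun d => if d < 2 * m + 1 then B ^ 2 * (M * K)
    else 4 * (M * B ^ 2 * (M * B ^ 2)) * a (d - 2 * m) with hv
  have hv0 : ∀ d, 0 ≤ v d := fun d => by
    have := h.a_nonneg (d - 2 * m)
    simp only [hv]; split_ifs <;> positivity
  have hsum : ∑ d ∈ Finset.range n, v d
      ≤ M * (B ^ 2 * (M * K)) + 4 * (M * B ^ 2 * (M * B ^ 2)) * ∑' k, a k := by
    calc ∑ d ∈ Finset.range n, v d ≤ ∑ d ∈ Finset.range (2 * m + 1 + n), v d :=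
          Finset.sum_le_sum_of_subset_of_nonneg (Finset.range_mono (by omega)) fun d _ _ => hv0 d
      _ = ∑ d ∈ Finset.range (2 * m + 1), v d + ∑ d ∈ Finset.range n, v (2 * m + 1 + d) :=
          Finset.sum_range_add _ _ _
      _ ≤ _ := by
          refine add_le_add ?_ ?_
          · rw [Finset.sum_congr rfl (g := fun _ => B ^ 2 * (M * K)) fun d hd => by
              simp only [hv, if_pos (Finset.mem_range.1 hd)]]
            simp [hM]
          · rw [Finset.sum_congr rfl
              (g := fun d => 4 * (M * B ^ 2 * (M * B ^ 2)) * a (d + 1)) fun d hd => by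
                simp only [hv]
                rw [if_neg (by omega), show 2 * m + 1 + d - 2 * m = d + 1 by omega],
              ← Finset.mul_sum]
            gcongr
            have h1 := ((summable_nat_add_iff 1).2 h.summ).sum_le_tsum (Finset.range n)
              fun d _ => h.a_nonneg (d + 1)
            have h2 := h.summ.sum_add_tsum_nat_add 1
            have h3 := h.a_nonneg 0
            simp only [Finset.range_one, Finset.sum_singleton] at h2
            linarith
  have hcov : ∀ i k, i + k < n →
      |∫ ω, (U i ω - ∫ ω', U i ω' ∂P) * (U (i + k) ω - ∫ ω', U (i + k) ω' ∂P) ∂P| ≤ v k := by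
    intro i k hik
    change |cov[U i, U (i + k); P]| ≤ v k
    simp only [hv]
    split_ifs with hk
    · refine (abs_cov_le_add_integral_sq (LU i) (LU (i + k))).trans ?_
      linarith [sqU i, sqU (i + k)]
    · refine AlphaLE.abs_cov_le (h.mix (i + m) (k - 2 * m)) (past_le h.meas _)
        (future_le h.meas _) ?_ ?_ (bU i) (bU (i + k))
      · exact (measurable_past Y (by omega)).mul (Finset.measurable_fun_sum _ fun l hl =>
          measurable_past Y (by simp only [window, Finset.mem_Ico] at hl; omega))
      · exact (measurable_future Y (by omega)).mul (Finset.measurable_fun_sum _ fun l hl =>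
          measurable_future Y (by simp only [window, Finset.mem_Ico] at hl; omega))
  refine (TimeSeries.integral_sum_sq_le (W := fun j ω => U j ω - ∫ ω', U j ω' ∂P)
    (Finset.Subset.refl _) hv0 (fun j => (LU j).sub (memLp_const _)) hcov).trans ?_
  rw [Finset.card_range, mul_assoc]
  refine mul_le_mul_of_nonneg_left ?_ n.cast_nonneg
  refine (mul_le_mul_of_nonneg_left hsum zero_le_two).trans_eq ?_
  ring

end BoundedMixing

end BoundedMixing

/-! ### Bounded mixing sequences: the differential inequality -/

section BoundedMixing

/-- The tails of the series of absolute values. -/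
noncomputable def absTail (r : ℕ → ℝ) (q : ℕ) : ℝ := ∑' k, |r (k + q)|

lemma absTail_nonneg (r : ℕ → ℝ) (q : ℕ) : 0 ≤ absTail r q := tsum_nonneg fun _ => abs_nonneg _

lemma tendsto_absTail (r : ℕ → ℝ) : Tendsto (absTail r) atTop (𝓝 0) :=
  tendsto_sum_nat_add fun k => |r k|

lemma abs_sum_range_sub_tsum_le {r : ℕ → ℝ} (hr : Summable fun k => |r k|) (q : ℕ) :
    |∑ k ∈ Finset.range q, r k - ∑' k, r k| ≤ absTail r q := by
  rw [← hr.of_abs.sum_add_tsum_nat_add q, sub_add_cancel_left, abs_neg]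
  exact norm_tsum_le_tsum_norm (f := fun k => r (k + q))
    ((summable_nat_add_iff (f := fun k => ‖r k‖) q).2 hr)

lemma absTail_anti {r : ℕ → ℝ} (hr : Summable fun k => |r k|) : Antitone (absTail r) := by
  refine antitone_nat_of_succ_le fun q => ?_
  have h1 := ((summable_nat_add_iff q).2 hr).sum_add_tsum_nat_add 1
  simp only [Finset.range_one, Finset.sum_singleton, zero_add] at h1
  simp only [absTail]
  rw [← h1]
  simp_rw [show ∀ k, k + (q + 1) = k + 1 + q by intro k; omega]
  linarith [abs_nonneg (r q)]

lemma absTail_min_le {r : ℕ → ℝ} (x y : ℕ) :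
    absTail r (min x y) ≤ absTail r x + absTail r y := by
  rcases min_choice x y with h | h <;> rw [h] <;>
    linarith [absTail_nonneg r x, absTail_nonneg r y]

variable {Ω : Type*} [MeasurableSpace Ω] {P : Measure Ω} {Y : ℕ → Ω → ℝ} {B : ℝ} {a r : ℕ → ℝ}

lemma integrable_mul_exp {f g : Ω → ℝ} (hf : Integrable f P) (hg : Measurable g) :
    Integrable (fun ω => (f ω : ℂ) * Complex.exp ((g ω : ℝ) * Complex.I)) P := by
  refine hf.ofReal.mul_bdd (c := 1) ?_ (ae_of_all _ fun ω =>
    (Complex.norm_exp_ofReal_mul_I _).le)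
  have : Measurable fun x : ℝ => Complex.exp (x * Complex.I) := by fun_prop
  exact (this.comp hg).aestronglyMeasurable

/-- The long-run variance of a sequence with covariances `r`. -/
noncomputable def longRunVar (r : ℕ → ℝ) : ℝ := r 0 + 2 * ∑' k, r (k + 1)

namespace BoundedMixing

variable (h : BoundedMixing Y P B a r) [IsProbabilityMeasure P]
include h

/-- The window is cut at `j`. The right half contains `j` itself, so its lags start at 0; the left
half is reversed, and its lags start at 1. -/
lemma integral_mul_windowSum {n m j : ℕ} (hj : j < n) :
    ∫ ω, Y j ω * windowSum Y n m j ω ∂P = ∑ k ∈ Finset.range (min m j), r (k + 1)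
      + ∑ k ∈ Finset.range (min (n - j) (m + 1)), r k := by
  have hint : ∀ i, Integrable (fun ω => Y j ω * Y i ω) P := fun i =>
    (h.memLp j).integrable_mul (h.memLp i)
  simp_rw [windowSum, Finset.mul_sum]
  rw [integral_finsetSum _ fun i _ => hint i, window,
    ← Finset.sum_Ico_consecutive _ (Nat.sub_le j m) (by omega)]
  congr 1
  · rw [Finset.sum_Ico_eq_sum_range, ← Finset.sum_range_reflect,
      show j - (j - m) = min m j by omega]
    refine Finset.sum_congr rfl fun k hk => ?_
    have hk' := Finset.mem_range.1 hk
    rw [← h.cov (j - (k + 1)) (k + 1)]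
    rw [show j - m + (min m j - 1 - k) = j - (k + 1) by omega,
      show j - (k + 1) + (k + 1) = j by omega]
    simp_rw [mul_comm (Y j _)]
  · rw [Finset.sum_Ico_eq_sum_range, show min n (j + m + 1) - j = min (n - j) (m + 1) by omega]
    exact Finset.sum_congr rfl fun k _ => h.cov j k

/-- Each half-window stops at the radius `m` or at an end of the range, and loses at most a tail of
the series there. The end effects depend on `j` and `n - j`, and vanish after averaging over `j`. -/
lemma abs_integral_mul_windowSum_sub_le {n m j : ℕ} (hj : j < n) :
    |∫ ω, Y j ω * windowSum Y n m j ω ∂P - longRunVar r|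
      ≤ 2 * absTail r m + absTail r j + absTail r (n - j) := by
  have hr := h.summable_abs_r
  have hr1 : Summable fun k => |r (k + 1)| := (summable_nat_add_iff 1).2 hr
  have h1 := abs_sum_range_sub_tsum_le hr1 (min m j)
  have h2 := abs_sum_range_sub_tsum_le hr (min (n - j) (m + 1))
  have h3 : longRunVar r = ∑' k, r (k + 1) + ∑' k, r k := by
    have := hr.of_abs.sum_add_tsum_nat_add 1
    simp only [Finset.range_one, Finset.sum_singleton] at this
    rw [longRunVar, ← this]; ring
  have h4 : absTail (fun k => r (k + 1)) (min m j) = absTail r (min m j + 1) := by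
    simp only [absTail, add_assoc]
  rw [h4] at h1
  have h5 := absTail_anti hr (Nat.le_succ (min m j))
  have h6 := absTail_min_le (r := r) m j
  have h7 := absTail_min_le (r := r) (n - j) (m + 1)
  have h8 := absTail_anti hr (Nat.le_succ m)
  rw [h.integral_mul_windowSum hj, h3]
  rw [abs_le] at h1 h2 ⊢
  constructor <;> linarith [h1.1, h1.2, h2.1, h2.2]

/-- The products of the variables with the sums over their windows satisfy a law of large
numbers. -/
lemma integral_abs_sum_mul_windowSum_sub_le (n m : ℕ) :
    ∫ ω, |∑ j ∈ Finset.range n, Y j ω * windowSum Y n m j ω - n * longRunVar r| ∂P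
      ≤ √n * (2 * m + 1) * √(2 * (B ^ 2 * (2 * ∑' k, |r k|) + 4 * B ^ 4 * ∑' k, a k))
        + (2 * n * absTail r m + 2 * ∑ j ∈ Finset.range n, absTail r j) := by
  set e : ℕ → ℝ := fun j => ∫ ω, Y j ω * windowSum Y n m j ω ∂P with he
  have LU : ∀ j, MemLp (fun ω => Y j ω * windowSum Y n m j ω) 2 P := fun j =>
    memLp_of_abs_le (b := B * ((2 * m + 1) * B)) ((h.meas j).mul (h.measurable_windowSum n m j))
      (fun ω => by
        rw [Pi.mul_apply, abs_mul]
        exact mul_le_mul (h.bound j ω) (h.abs_windowSum_le n m j ω) (abs_nonneg _)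
          (nonneg_of_forall_abs_le P (h.bound 0))) 2
  have LT : MemLp (fun ω => ∑ j ∈ Finset.range n, (Y j ω * windowSum Y n m j ω - e j)) 2 P :=
    memLp_finsetSum _ fun j _ => (LU j).sub (memLp_const _)
  have h1 := integral_abs_le_sqrt LT
  have h2 := Real.sqrt_le_sqrt (h.integral_sum_mul_windowSum_sq_le n m)
  rw [Real.sqrt_mul (by positivity), Real.sqrt_mul (by positivity),
    Real.sqrt_sq (by positivity)] at h2
  have h3 : |∑ j ∈ Finset.range n, (e j - longRunVar r)|
      ≤ 2 * n * absTail r m + 2 * ∑ j ∈ Finset.range n, absTail r j := by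
    refine (Finset.abs_sum_le_sum_abs _ _).trans ?_
    refine (Finset.sum_le_sum fun j hj =>
      h.abs_integral_mul_windowSum_sub_le (m := m) (Finset.mem_range.1 hj)).trans ?_
    rw [Finset.sum_add_distrib, Finset.sum_add_distrib]
    -- Reversal of the range turns `n - 1 - j` into `j`; monotonicity of the tails absorbs the shift
    -- by one.
    have h4 : ∑ j ∈ Finset.range n, absTail r (n - j) ≤ ∑ j ∈ Finset.range n, absTail r j := by
      rw [← Finset.sum_range_reflect (fun j => absTail r j)]
      refine Finset.sum_le_sum fun j hj => absTail_anti h.summable_abs_r ?_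
      omega
    simp only [Finset.sum_const, Finset.card_range, nsmul_eq_mul]
    linarith
  have h4 : ∀ ω, |∑ j ∈ Finset.range n, Y j ω * windowSum Y n m j ω - n * longRunVar r|
      ≤ |∑ j ∈ Finset.range n, (Y j ω * windowSum Y n m j ω - e j)|
        + |∑ j ∈ Finset.range n, (e j - longRunVar r)| := fun ω => by
    refine le_trans (le_of_eq ?_) (abs_add_le _ _)
    congr 1
    simp only [Finset.sum_sub_distrib, Finset.sum_const, Finset.card_range, nsmul_eq_mul]
    ring
  have iT := (LT.integrable one_le_two).abs
  calc _ ≤ ∫ ω, (|∑ j ∈ Finset.range n, (Y j ω * windowSum Y n m j ω - e j)|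
        + |∑ j ∈ Finset.range n, (e j - longRunVar r)|) ∂P := by
        refine integral_mono_of_nonneg (ae_of_all _ fun ω => abs_nonneg _)
          (iT.add (integrable_const _)) (ae_of_all _ h4)
    _ = ∫ ω, |∑ j ∈ Finset.range n, (Y j ω * windowSum Y n m j ω - e j)| ∂P
        + |∑ j ∈ Finset.range n, (e j - longRunVar r)| := by
        rw [integral_add iT (integrable_const _)]; simp
    _ ≤ _ := add_le_add (h1.trans h2) h3

/-- The differential inequality for the characteristic function of a sum, before rescaling. -/
lemma norm_integral_sum_mul_exp_sub_le (n m : ℕ) (s : ℝ) :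
    ‖∫ ω, ((∑ j ∈ Finset.range n, Y j ω : ℝ) : ℂ)
          * Complex.exp ((s * ∑ j ∈ Finset.range n, Y j ω : ℝ) * Complex.I) ∂P
        - s * Complex.I * (n * longRunVar r : ℝ)
          * ∫ ω, Complex.exp ((s * ∑ j ∈ Finset.range n, Y j ω : ℝ) * Complex.I) ∂P‖
      ≤ n * (32 * B * a (m + 1)) + n * (B * s ^ 2 * ((2 * m + 1) * (2 * ∑' k, |r k|)))
        + |s| * ∫ ω, |∑ j ∈ Finset.range n, Y j ω * windowSum Y n m j ω - n * longRunVar r| ∂P := by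
  have hB : 0 ≤ B := nonneg_of_forall_abs_le P (h.bound 0)
  set S : Ω → ℝ := fun ω => s * ∑ j ∈ Finset.range n, Y j ω with hS
  have mS : Measurable S := (Finset.measurable_fun_sum _ fun i _ => h.meas i).const_mul s
  set E : Ω → ℂ := fun ω => Complex.exp ((S ω : ℝ) * Complex.I) with hE
  have nE : ∀ ω, ‖E ω‖ = 1 := fun ω => Complex.norm_exp_ofReal_mul_I _
  set O : ℕ → Ω → ℂ := fun j ω => Complex.exp ((s * outerSum Y n m j ω : ℝ) * Complex.I) with hO
  have iY : ∀ j, Integrable (Y j) P := fun j => (h.memLp j).integrable one_le_two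
  have LW : ∀ j, MemLp (windowSum Y n m j) 2 P := fun j =>
    memLp_of_abs_le (h.measurable_windowSum n m j) (h.abs_windowSum_le n m j) 2
  have iYW : ∀ j, Integrable (fun ω => Y j ω * windowSum Y n m j ω) P := fun j =>
    (h.memLp j).integrable_mul (LW j)
  set T : Ω → ℝ := fun ω => ∑ j ∈ Finset.range n, Y j ω * windowSum Y n m j ω - n * longRunVar r
    with hT
  have iT : Integrable T P := (integrable_finsetSum _ fun j _ => iYW j).sub (integrable_const _)
  -- the Taylor remainders
  set Q : ℕ → Ω → ℂ := fun j ω => (Y j ω : ℂ) * E ω - (Y j ω : ℂ) * O j ω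
    - s * Complex.I * (((Y j ω * windowSum Y n m j ω : ℝ) : ℂ) * E ω) with hQ
  have iO : ∀ j, Integrable (fun ω => (Y j ω : ℂ) * O j ω) P := fun j =>
    integrable_mul_exp (iY j) ((h.measurable_outerSum n m j).const_mul s)
  have iQ : ∀ j, Integrable (Q j) P := fun j =>
    ((integrable_mul_exp (iY j) mS).sub (iO j)).sub ((integrable_mul_exp (iYW j) mS).const_mul _)
  have nQ : ∀ j ∈ Finset.range n, ∀ ω, ‖Q j ω‖ ≤ B * s ^ 2 * windowSum Y n m j ω ^ 2 := by
    intro j hj ω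
    -- Expanding about the full exponential `E`, not the outer one, leaves `E` as a common factor of
    -- all the linear terms, so that `∑ Y_j W_j` can be replaced by its limit as a whole.
    have hO' : O j ω = E ω * Complex.exp ((-(s * windowSum Y n m j ω) : ℝ) * Complex.I) := by
      simp only [hO, hE, hS]
      rw [sum_range_eq_outerSum_add (m := m) (Finset.mem_range.1 hj), ← Complex.exp_add]
      congr 1
      push_cast; ring
    have e : Q j ω = -((Y j ω : ℂ) * E ω
        * (Complex.exp ((-(s * windowSum Y n m j ω) : ℝ) * Complex.I) - 1
          - (-(s * windowSum Y n m j ω) : ℝ) * Complex.I)) := by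
      simp only [hQ]
      rw [hO']
      push_cast; ring
    rw [e, norm_neg, norm_mul, norm_mul, nE, mul_one, Complex.norm_real, mul_assoc]
    refine mul_le_mul (h.bound j ω) ((norm_exp_I_mul_sub_le _).trans_eq ?_) (norm_nonneg _) hB
    ring
  have hsplit : ∀ ω, ((∑ j ∈ Finset.range n, Y j ω : ℝ) : ℂ) * E ω
      - s * Complex.I * (n * longRunVar r : ℝ) * E ω
      = ∑ j ∈ Finset.range n, (Y j ω : ℂ) * O j ω + ∑ j ∈ Finset.range n, Q j ω
        + s * Complex.I * ((T ω : ℂ) * E ω) := by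
    intro ω
    simp only [hQ, hT, Finset.sum_sub_distrib, ← Finset.mul_sum, ← Finset.sum_mul]
    push_cast
    ring
  have iE : Integrable E P := by
    simpa using integrable_mul_exp (integrable_const (μ := P) (1 : ℝ)) mS
  have iSE : Integrable (fun ω => ((∑ j ∈ Finset.range n, Y j ω : ℝ) : ℂ) * E ω) P :=
    integrable_mul_exp (integrable_finsetSum _ fun j _ => iY j) mS
  rw [← integral_const_mul, ← integral_sub iSE (iE.const_mul _)]
  simp_rw [hsplit]
  have iA : Integrable (fun ω => ∑ j ∈ Finset.range n, (Y j ω : ℂ) * O j ω) P :=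
    integrable_finsetSum _ fun j _ => iO j
  have iB : Integrable (fun ω => ∑ j ∈ Finset.range n, Q j ω) P :=
    integrable_finsetSum _ fun j _ => iQ j
  have iAB : Integrable (fun ω => ∑ j ∈ Finset.range n, (Y j ω : ℂ) * O j ω
      + ∑ j ∈ Finset.range n, Q j ω) P := iA.add iB
  rw [integral_add iAB ((integrable_mul_exp iT mS).const_mul _), integral_add iA iB,
    integral_finsetSum _ fun j _ => iO j, integral_finsetSum _ fun j _ => iQ j,
    integral_const_mul]
  refine (norm_add₃_le).trans (add_le_add (add_le_add ?_ ?_) ?_)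
  · refine (norm_sum_le _ _).trans ?_
    refine (Finset.sum_le_card_nsmul _ _ _ fun j _ =>
      h.norm_integral_mul_exp_outerSum_le n m j s).trans_eq ?_
    rw [Finset.card_range, nsmul_eq_mul]
  · refine (norm_sum_le _ _).trans ?_
    refine (Finset.sum_le_card_nsmul _ _ (B * s ^ 2 * ((2 * m + 1) * (2 * ∑' k, |r k|)))
      fun j hj => ?_).trans_eq (by rw [Finset.card_range, nsmul_eq_mul])
    calc _ ≤ ∫ ω, B * s ^ 2 * windowSum Y n m j ω ^ 2 ∂P :=
          norm_integral_le_of_norm_le ((LW j).integrable_sq.const_mul _) (ae_of_all _ (nQ j hj))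
      _ ≤ _ := by
          rw [integral_const_mul]
          gcongr
          exact h.integral_windowSum_sq_le n m j
  · rw [norm_mul, norm_mul, Complex.norm_I, mul_one, Complex.norm_real, Real.norm_eq_abs]
    gcongr
    refine norm_integral_le_of_norm_le iT.abs (ae_of_all _ fun ω => ?_)
    rw [norm_mul]
    simp only [Complex.norm_real, Real.norm_eq_abs]
    rw [show ‖Complex.exp ((S ω : ℝ) * Complex.I)‖ = 1 from nE ω, mul_one]

end BoundedMixing

end BoundedMixing

/-! ### Central limit theorem for bounded mixing sequences -/

section BoundedCLT

variable {Ω : Type*} [MeasurableSpace Ω] {P : Measure Ω} {Y : ℕ → Ω → ℝ} {B : ℝ} {a r : ℕ → ℝ}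

lemma hasDerivAt_integral_exp [IsProbabilityMeasure P] {Z : Ω → ℝ} (hZ : Measurable Z)
    (hi : Integrable Z P) (t : ℝ) :
    HasDerivAt (fun t : ℝ => ∫ ω, Complex.exp ((t * Z ω : ℝ) * Complex.I) ∂P)
      (∫ ω, (Z ω : ℂ) * Complex.I * Complex.exp ((t * Z ω : ℝ) * Complex.I) ∂P) t := by
  have hm : ∀ t : ℝ, Measurable fun ω => Complex.exp ((t * Z ω : ℝ) * Complex.I) := fun t => by
    have : Measurable fun x : ℝ => Complex.exp ((t * x : ℝ) * Complex.I) := by fun_prop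
    exact this.comp hZ
  have n1 : ∀ (t : ℝ) ω, ‖Complex.exp ((t * Z ω : ℝ) * Complex.I)‖ = 1 := fun t ω =>
    Complex.norm_exp_ofReal_mul_I _
  refine (hasDerivAt_integral_of_dominated_loc_of_deriv_le (s := Set.univ)
    (bound := fun ω => |Z ω|)
    (F' := fun t ω => (Z ω : ℂ) * Complex.I * Complex.exp ((t * Z ω : ℝ) * Complex.I))
    univ_mem (Eventually.of_forall fun t => (hm t).aestronglyMeasurable)
    (Integrable.of_bound (hm t).aestronglyMeasurable 1 (ae_of_all _ fun ω => (n1 t ω).le)) ?_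
    (ae_of_all _ fun ω t _ => ?_) hi.abs (ae_of_all _ fun ω t _ => ?_)).2
  · exact (((Complex.measurable_ofReal.comp hZ).mul_const _).mul (hm t)).aestronglyMeasurable
  · rw [norm_mul, n1, norm_mul, Complex.norm_I, Complex.norm_real]
    simp
  · have h1 : HasDerivAt (fun t : ℝ => (t : ℂ)) 1 t := Complex.ofRealCLM.hasDerivAt (x := t)
    convert! ((h1.mul_const (Z ω : ℂ)).mul_const Complex.I).cexp using 1
    · ext t; push_cast; rfl
    · push_cast; ring

namespace BoundedMixing

variable (h : BoundedMixing Y P B a r) [IsProbabilityMeasure P]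
include h

/-- This is the unscaled estimate at frequency `t/√n`, multiplied by `i/√n`: the product `(i/√n)(i
t/√n) n σ²` equals `-t σ²`. The bound depends on `τ` only, because the differential inequality is
integrated over `|t| ≤ τ`. -/
lemma norm_deriv_charFun_add_le {n : ℕ} (hn : 0 < n) (m : ℕ) {t τ : ℝ} (ht : |t| ≤ τ) :
    ‖∫ ω, (((√n)⁻¹ * ∑ j ∈ Finset.range n, Y j ω : ℝ) : ℂ) * Complex.I
          * Complex.exp ((t * ((√n)⁻¹ * ∑ j ∈ Finset.range n, Y j ω) : ℝ) * Complex.I) ∂P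
        + t * (longRunVar r : ℝ)
          * ∫ ω, Complex.exp ((t * ((√n)⁻¹ * ∑ j ∈ Finset.range n, Y j ω) : ℝ) * Complex.I) ∂P‖
      ≤ 32 * B * (√n * a (m + 1))
        + (B * τ ^ 2 * (2 * ∑' k, |r k|)
            + τ * √(2 * (B ^ 2 * (2 * ∑' k, |r k|) + 4 * B ^ 4 * ∑' k, a k)))
          * ((2 * m + 1) / √n)
        + τ * (2 * absTail r m + 2 * ((n : ℝ)⁻¹ * ∑ j ∈ Finset.range n, absTail r j)) := by
  have hB : 0 ≤ B := nonneg_of_forall_abs_le P (h.bound 0)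
  have hn' : (0 : ℝ) < √n := Real.sqrt_pos.2 (by exact_mod_cast hn)
  have hnn : (√n : ℝ) * √n = n := Real.mul_self_sqrt n.cast_nonneg
  have hK : (0 : ℝ) ≤ ∑' k, |r k| := tsum_nonneg fun _ => abs_nonneg _
  have h1 := h.norm_integral_sum_mul_exp_sub_le n m (t * (√n)⁻¹)
  have h2 := h.integral_abs_sum_mul_windowSum_sub_le n m
  set c : ℝ := √(2 * (B ^ 2 * (2 * ∑' k, |r k|) + 4 * B ^ 4 * ∑' k, a k)) with hc
  set D : ℝ := ∫ ω, |∑ j ∈ Finset.range n, Y j ω * windowSum Y n m j ω - n * longRunVar r| ∂P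
  have hT : 0 ≤ ∑ j ∈ Finset.range n, absTail r j := Finset.sum_nonneg fun j _ => absTail_nonneg r j
  have hTm := absTail_nonneg r m
  have e : ∫ ω, (((√n)⁻¹ * ∑ j ∈ Finset.range n, Y j ω : ℝ) : ℂ) * Complex.I
          * Complex.exp ((t * ((√n)⁻¹ * ∑ j ∈ Finset.range n, Y j ω) : ℝ) * Complex.I) ∂P
        + t * (longRunVar r : ℝ)
          * ∫ ω, Complex.exp ((t * ((√n)⁻¹ * ∑ j ∈ Finset.range n, Y j ω) : ℝ) * Complex.I) ∂P
      = ((√n)⁻¹ : ℝ) * Complex.I *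
        (∫ ω, ((∑ j ∈ Finset.range n, Y j ω : ℝ) : ℂ)
          * Complex.exp ((t * (√n)⁻¹ * ∑ j ∈ Finset.range n, Y j ω : ℝ) * Complex.I) ∂P
        - (t * (√n)⁻¹ : ℝ) * Complex.I * (n * longRunVar r : ℝ)
          * ∫ ω, Complex.exp ((t * (√n)⁻¹ * ∑ j ∈ Finset.range n, Y j ω : ℝ) * Complex.I) ∂P) := by
    simp_rw [← mul_assoc t]
    have e0 : ∫ ω, (((√n)⁻¹ * ∑ j ∈ Finset.range n, Y j ω : ℝ) : ℂ) * Complex.I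
          * Complex.exp ((t * (√n)⁻¹ * ∑ j ∈ Finset.range n, Y j ω : ℝ) * Complex.I) ∂P
        = ((√n)⁻¹ : ℝ) * Complex.I * ∫ ω, ((∑ j ∈ Finset.range n, Y j ω : ℝ) : ℂ)
          * Complex.exp ((t * (√n)⁻¹ * ∑ j ∈ Finset.range n, Y j ω : ℝ) * Complex.I) ∂P := by
      rw [← integral_const_mul]
      refine integral_congr_ae (ae_of_all _ fun ω => ?_)
      simp only [Complex.ofReal_mul]
      ring
    have e1 : (((√n)⁻¹ : ℝ) : ℂ) * (((√n)⁻¹ : ℝ) : ℂ) * ((n : ℝ) : ℂ) = 1 := by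
      rw [← Complex.ofReal_mul, ← Complex.ofReal_mul, ← Complex.ofReal_one]
      congr 1
      rw [← mul_inv, hnn]
      exact inv_mul_cancel₀ (by exact_mod_cast hn.ne')
    have e2 : (((√n)⁻¹ : ℝ) : ℂ) * Complex.I * ((t * (√n)⁻¹ : ℝ) * Complex.I
        * (n * longRunVar r : ℝ)) = - (t * (longRunVar r : ℝ)) := by
      rw [Complex.ofReal_mul t, Complex.ofReal_mul (n : ℝ)]
      calc _ = (((√n)⁻¹ : ℝ) : ℂ) * (((√n)⁻¹ : ℝ) : ℂ) * ((n : ℝ) : ℂ) * (Complex.I * Complex.I)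
            * (t * (longRunVar r : ℝ)) := by ring
        _ = _ := by rw [e1, Complex.I_mul_I]; ring
    rw [e0, mul_sub, ← mul_assoc (((√n)⁻¹ : ℝ) * Complex.I : ℂ) (_ * _), e2]
    ring
  rw [e, norm_mul, norm_mul, Complex.norm_I, mul_one, Complex.norm_real,
    Real.norm_of_nonneg (by positivity)]
  have hτ : 0 ≤ τ := (abs_nonneg t).trans ht
  have ht2 : t ^ 2 ≤ τ ^ 2 := by rw [← sq_abs]; gcongr
  calc _ ≤ (√n)⁻¹ * (n * (32 * B * a (m + 1))
        + n * (B * (t * (√n)⁻¹) ^ 2 * ((2 * m + 1) * (2 * ∑' k, |r k|)))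
        + |t * (√n)⁻¹| * (√n * (2 * m + 1) * c
          + (2 * n * absTail r m + 2 * ∑ j ∈ Finset.range n, absTail r j))) := by
        gcongr
        exact h1.trans (by gcongr)
    _ = 32 * B * (√n * a (m + 1))
        + (B * t ^ 2 * (2 * ∑' k, |r k|) + |t| * c) * ((2 * m + 1) / √n)
        + |t| * (2 * absTail r m + 2 * ((n : ℝ)⁻¹ * ∑ j ∈ Finset.range n, absTail r j)) := by
        rw [abs_mul, abs_of_nonneg (inv_nonneg.2 hn'.le)]
        clear_value c D
        clear e h1 h2 hc
        generalize √(n : ℝ) = q at hn' hnn ⊢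
        rw [← hnn]
        field_simp
        ring
    _ ≤ _ := by
        have := Real.sqrt_nonneg (2 * (B ^ 2 * (2 * ∑' k, |r k|) + 4 * B ^ 4 * ∑' k, a k))
        gcongr

omit [IsProbabilityMeasure P] in
-- With `k = ⌊ε√n⌋ + 1` one has `√n ≤ k/ε`, and `k a k` tends to 0.
lemma tendsto_sqrt_mul_a {ε : ℝ} (hε : 0 < ε) :
    Tendsto (fun n : ℕ => √n * a (⌊ε * √n⌋₊ + 1)) atTop (𝓝 0) := by
  have hm : Tendsto (fun n : ℕ => ⌊ε * √n⌋₊ + 1) atTop atTop :=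
    (tendsto_add_atTop_nat 1).comp (tendsto_nat_floor_atTop.comp
      ((Real.tendsto_sqrt_atTop.comp tendsto_natCast_atTop_atTop).const_mul_atTop hε))
  have h1 := ((tendsto_mul_of_antitone_summable h.anti h.summ).comp hm).const_mul ε⁻¹
  rw [mul_zero] at h1
  refine squeeze_zero (fun n => mul_nonneg (Real.sqrt_nonneg _) (h.a_nonneg _)) (fun n => ?_) h1
  simp only [Function.comp_apply]
  rw [← mul_assoc]
  refine mul_le_mul_of_nonneg_right ?_ (h.a_nonneg _)
  rw [inv_mul_eq_div, le_div_iff₀ hε, mul_comm]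
  push_cast
  exact (Nat.lt_floor_add_one _).le

/-- Central limit theorem for bounded sequences with summable alpha-mixing coefficients. -/
theorem tendsto_charFun (t : ℝ) :
    Tendsto (fun n : ℕ => ∫ ω, Complex.exp
        ((t * ((√n)⁻¹ * ∑ j ∈ Finset.range n, Y j ω) : ℝ) * Complex.I) ∂P) atTop
      (𝓝 (Complex.exp (-((longRunVar r : ℝ) * t ^ 2 / 2)))) := by
  have hB : 0 ≤ B := nonneg_of_forall_abs_le P (h.bound 0)
  have hK : (0 : ℝ) ≤ ∑' k, |r k| := tsum_nonneg fun _ => abs_nonneg _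
  set C : ℝ := B * |t| ^ 2 * (2 * ∑' k, |r k|)
            + |t| * √(2 * (B ^ 2 * (2 * ∑' k, |r k|) + 4 * B ^ 4 * ∑' k, a k)) with hC
  have hC0 : 0 ≤ C := by positivity
  have key : ∀ η : ℝ, 0 < η → ∀ᶠ n : ℕ in atTop, ∃ m : ℕ,
      32 * B * (√n * a (m + 1)) + C * ((2 * m + 1) / √n)
        + |t| * (2 * absTail r m + 2 * ((n : ℝ)⁻¹ * ∑ j ∈ Finset.range n, absTail r j)) ≤ η := by
    intro η hη
    -- With `m = ⌊ε√n⌋` the term `C (2m+1)/√n` does not vanish, but its upper bound tends to `2 C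
    -- ε`, which this choice keeps at most `η/2`; the other terms tend to 0.
    set ε : ℝ := η / (4 * (C + 1)) with hε
    have hε0 : 0 < ε := by positivity
    have hsq : Tendsto (fun n : ℕ => √(n : ℝ)) atTop atTop :=
      Real.tendsto_sqrt_atTop.comp tendsto_natCast_atTop_atTop
    have hm : Tendsto (fun n : ℕ => ⌊ε * √n⌋₊) atTop atTop :=
      tendsto_nat_floor_atTop.comp (hsq.const_mul_atTop hε0)
    have l1 := (h.tendsto_sqrt_mul_a hε0).const_mul (32 * B)
    have l2 := ((hsq.inv_tendsto_atTop.const_add (2 * ε)).const_mul C)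
    have l3 := (((tendsto_absTail r).comp hm).const_mul 2).add
      ((tendsto_absTail r).cesaro.const_mul 2) |>.const_mul |t|
    have l4 := (l1.add l2).add l3
    have hlim : 32 * B * 0 + C * (2 * ε + 0) + |t| * (2 * 0 + 2 * 0) < η := by
      have : C * (2 * ε) = (C / (C + 1)) * (η / 2) := by rw [hε]; field_simp; norm_num
      have h2 : C / (C + 1) ≤ 1 := div_le_one_of_le₀ (by linarith) (by linarith)
      have h3 : (C / (C + 1)) * (η / 2) ≤ 1 * (η / 2) := by gcongr
      simp only [mul_zero, add_zero, zero_add]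
      linarith
    filter_upwards [l4.eventually (gt_mem_nhds hlim), eventually_gt_atTop 0] with n hn hn0
    refine ⟨⌊ε * √n⌋₊, le_trans ?_ hn.le⟩
    have hs : (0 : ℝ) < √n := Real.sqrt_pos.2 (by exact_mod_cast hn0)
    simp only [Function.comp_apply, Pi.inv_apply]
    gcongr
    rw [div_le_iff₀ hs, add_mul, inv_mul_cancel₀ hs.ne']
    have := Nat.floor_le (mul_nonneg hε0.le hs.le)
    linarith
  set A : ℝ := Real.exp (|longRunVar r| * t ^ 2) * |t| with hA
  have hA0 : 0 ≤ A := by positivity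
  rw [Metric.tendsto_atTop']
  intro δ hδ
  have hη : 0 < δ / (2 * (A + 1)) := by positivity
  obtain ⟨N, hN⟩ := eventually_atTop.1 (key _ hη)
  refine ⟨N, fun n hn => ?_⟩
  obtain ⟨m, hm⟩ := hN n hn.le
  have hn0 : 0 < n := by omega
  have mZ : Measurable fun ω => (√n)⁻¹ * ∑ j ∈ Finset.range n, Y j ω :=
    (Finset.measurable_fun_sum _ fun i _ => h.meas i).const_mul _
  have iZ : Integrable (fun ω => (√n)⁻¹ * ∑ j ∈ Finset.range n, Y j ω) P :=
    (integrable_finsetSum _ fun j _ => (h.memLp j).integrable one_le_two).const_mul _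
  have := norm_sub_exp_le_of_deriv (s := longRunVar r) (t := t) (by simp)
    (hasDerivAt_integral_exp mZ iZ)
    (fun x hx => (h.norm_deriv_charFun_add_le hn0 m hx).trans hm)
  rw [dist_eq_norm]
  refine this.trans_lt ?_
  calc δ / (2 * (A + 1)) * A = (A / (A + 1)) * (δ / 2) := by field_simp
    _ ≤ 1 * (δ / 2) := by
      gcongr
      exact div_le_one_of_le₀ (by linarith) (by linarith)
    _ < δ := by linarith

end BoundedMixing

end BoundedCLT

/-! ### Central limit theorem for functions of successive pairs, by truncation -/

section GeneralCLT

variable {Ω : Type*} [MeasurableSpace Ω] {P : Measure Ω} {X : ℕ → Ω → ℝ} {p : ℝ} {a c : ℕ → ℝ}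

/-- The pairs of successive variables. -/
def pairs (X : ℕ → Ω → ℝ) (i : ℕ) (ω : Ω) : ℝ × ℝ := (X i ω, X (i + 1) ω)

lemma measurable_pairs (hX : ∀ i, Measurable (X i)) (i : ℕ) : Measurable (pairs X i) :=
  (hX i).prodMk (hX (i + 1))

/-- The pairs of successive variables of a stationary sequence with alpha-mixing coefficients `a`
have summable covariances, uniformly over functions with bounded moments of order `p`. -/
structure CovDecay (X : ℕ → Ω → ℝ) (P : Measure Ω) (p : ℝ) (a c : ℕ → ℝ) : Prop where
  meas : ∀ i, Measurable (X i)
  stat : StrictlyStationary X P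
  two_le : 2 ≤ p
  nonneg : ∀ k, 0 ≤ c k
  summ : Summable c
  cov_le : ∀ (k : ℕ) (f g : ℝ × ℝ → ℝ), Measurable f → Measurable g →
    MemLp (fun ω => f (pairs X 0 ω)) (ENNReal.ofReal p) P →
    MemLp (fun ω => g (pairs X 0 ω)) (ENNReal.ofReal p) P → ∀ η : ℝ, 0 < η →
    ∫ ω, |f (pairs X 0 ω)| ^ p ∂P ≤ η → ∫ ω, |g (pairs X 0 ω)| ^ p ∂P ≤ η →
    |cov[fun ω => f (pairs X 0 ω), fun ω => g (pairs X k ω); P]| ≤ c k * η ^ (2 / p)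
  mix : ∀ i k, AlphaLE P (past X (i + 1)) (future X (i + k)) (a k)
  anti : Antitone a
  summ_a : Summable a

lemma StrictlyStationary.identDistrib_pairs (h : StrictlyStationary X P) (i : ℕ) :
    IdentDistrib (pairs X i) (pairs X 0) P P := by
  have hm : Measurable fun x : ℕ → ℝ => (x 0, x 1) :=
    (measurable_pi_apply 0).prodMk (measurable_pi_apply 1)
  have := (h i).comp hm
  have e1 : (fun x : ℕ → ℝ => (x 0, x 1)) ∘ (fun ω k => X (k + i) ω) = pairs X i := by
    ext ω <;> simp [pairs, add_comm]
  have e2 : (fun x : ℕ → ℝ => (x 0, x 1)) ∘ (fun ω k => X k ω) = pairs X 0 := by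
    ext ω <;> simp [pairs]
  rwa [e1, e2] at this

lemma StrictlyStationary.identDistrib_pairs_prod (h : StrictlyStationary X P) (i k : ℕ) :
    IdentDistrib (fun ω => (pairs X i ω, pairs X (i + k) ω))
      (fun ω => (pairs X 0 ω, pairs X k ω)) P P := by
  have hm : Measurable fun x : ℕ → ℝ => ((x 0, x 1), (x k, x (k + 1))) :=
    ((measurable_pi_apply 0).prodMk (measurable_pi_apply 1)).prodMk
      ((measurable_pi_apply k).prodMk (measurable_pi_apply (k + 1)))
  have := (h i).comp hm
  have e1 : (fun x : ℕ → ℝ => ((x 0, x 1), (x k, x (k + 1)))) ∘ (fun ω k => X (k + i) ω)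
      = fun ω => (pairs X i ω, pairs X (i + k) ω) := by
    ext ω <;> simp [pairs, add_comm, add_assoc]
  have e2 : (fun x : ℕ → ℝ => ((x 0, x 1), (x k, x (k + 1)))) ∘ (fun ω k => X k ω)
      = fun ω => (pairs X 0 ω, pairs X k ω) := by
    ext ω <;> simp [pairs]
  rwa [e1, e2] at this

lemma StrictlyStationary.identDistrib_comp (h : StrictlyStationary X P) {f : ℝ × ℝ → ℝ}
    (hf : Measurable f) (i : ℕ) :
    IdentDistrib (fun ω => f (pairs X i ω)) (fun ω => f (pairs X 0 ω)) P P :=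
  (h.identDistrib_pairs i).comp hf

lemma StrictlyStationary.integral_comp (h : StrictlyStationary X P) {f : ℝ × ℝ → ℝ}
    (hf : Measurable f) (i : ℕ) :
    ∫ ω, f (pairs X i ω) ∂P = ∫ ω, f (pairs X 0 ω) ∂P :=
  (h.identDistrib_comp hf i).integral_eq

lemma StrictlyStationary.memLp_comp (h : StrictlyStationary X P) {f : ℝ × ℝ → ℝ}
    (hf : Measurable f) {q : ENNReal} (hq : MemLp (fun ω => f (pairs X 0 ω)) q P) (i : ℕ) :
    MemLp (fun ω => f (pairs X i ω)) q P :=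
  (h.identDistrib_comp hf i).memLp_iff.2 hq

lemma StrictlyStationary.covariance_comp (h : StrictlyStationary X P) {f g : ℝ × ℝ → ℝ}
    (hf : Measurable f) (hg : Measurable g) (i k : ℕ) :
    cov[fun ω => f (pairs X i ω), fun ω => g (pairs X (i + k) ω); P]
      = cov[fun ω => f (pairs X 0 ω), fun ω => g (pairs X k ω); P] := by
  unfold covariance
  rw [h.integral_comp hf i, h.integral_comp hg (i + k), h.integral_comp hg k]
  have hm : Measurable fun z : (ℝ × ℝ) × (ℝ × ℝ) =>
      (f z.1 - ∫ ω, f (pairs X 0 ω) ∂P) * (g z.2 - ∫ ω, g (pairs X 0 ω) ∂P) :=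
    ((hf.comp measurable_fst).sub_const _).mul ((hg.comp measurable_snd).sub_const _)
  exact ((h.identDistrib_pairs_prod i k).comp hm).integral_eq

lemma tendsto_cut (x : ℝ) : Tendsto (fun N : ℕ => cut N x) atTop (𝓝 x) := by
  refine tendsto_const_nhds.congr' ?_
  filter_upwards [tendsto_natCast_atTop_atTop.eventually_ge_atTop |x|] with N hN
  rw [cut, if_pos hN]

lemma norm_integral_exp_sub_le [IsProbabilityMeasure P] {U V : Ω → ℝ} (hU : Measurable U)
    (hV : Measurable V) (hUV : MemLp (fun ω => U ω - V ω) 2 P) (t : ℝ) :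
    ‖∫ ω, Complex.exp ((t * U ω : ℝ) * Complex.I) ∂P
        - ∫ ω, Complex.exp ((t * V ω : ℝ) * Complex.I) ∂P‖
      ≤ |t| * √(∫ ω, (U ω - V ω) ^ 2 ∂P) := by
  have hi : ∀ {U : Ω → ℝ}, Measurable U →
      Integrable (fun ω => Complex.exp ((t * U ω : ℝ) * Complex.I)) P := fun hU => by
    simpa using integrable_mul_exp (integrable_const (μ := P) (1 : ℝ)) (hU.const_mul t)
  rw [← integral_sub (hi hU) (hi hV)]
  calc _ ≤ ∫ ω, |t| * |U ω - V ω| ∂P := by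
        refine norm_integral_le_of_norm_le ((hUV.integrable one_le_two).abs.const_mul _)
          (ae_of_all _ fun ω => ?_)
        have e : Complex.exp ((t * U ω : ℝ) * Complex.I) - Complex.exp ((t * V ω : ℝ) * Complex.I)
            = Complex.exp ((t * V ω : ℝ) * Complex.I)
              * (Complex.exp (Complex.I * (t * (U ω - V ω) : ℝ)) - 1) := by
          rw [mul_sub, ← Complex.exp_add, mul_one]
          congr 2
          push_cast; ring
        rw [e, norm_mul, Complex.norm_exp_ofReal_mul_I, one_mul, ← abs_mul]
        exact Real.norm_exp_I_mul_ofReal_sub_one_le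
    _ ≤ _ := by
        rw [integral_const_mul]
        gcongr
        exact integral_abs_le_sqrt hUV

namespace CovDecay

variable (h : CovDecay X P p a c) [IsProbabilityMeasure P]
include h

omit [IsProbabilityMeasure P] in
lemma pos : 0 < p := by linarith [h.two_le]

lemma memLp_two {f : Ω → ℝ} (hf : MemLp f (ENNReal.ofReal p) P) : MemLp f 2 P :=
  hf.mono_exponent (by
    rw [show (2 : ENNReal) = ENNReal.ofReal 2 by simp]
    exact ENNReal.ofReal_le_ofReal h.two_le)

omit [IsProbabilityMeasure P] in
lemma integrable_rpow {f : Ω → ℝ} (hf : MemLp f (ENNReal.ofReal p) P) :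
    Integrable (fun ω => |f ω| ^ p) P := by
  have := hf.integrable_norm_rpow (by simpa using h.pos) ENNReal.ofReal_ne_top
  rwa [ENNReal.toReal_ofReal h.pos.le] at this

/-- Second moments of centred sums. -/
lemma integral_sum_sub_sq_le {f : ℝ × ℝ → ℝ} (hf : Measurable f)
    (hfp : MemLp (fun ω => f (pairs X 0 ω)) (ENNReal.ofReal p) P) {η : ℝ} (hη : 0 < η)
    (hfη : ∫ ω, |f (pairs X 0 ω)| ^ p ∂P ≤ η) (n : ℕ) :
    ∫ ω, (∑ j ∈ Finset.range n, (f (pairs X j ω) - ∫ ω', f (pairs X 0 ω') ∂P)) ^ 2 ∂P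
      ≤ n * (2 * ((∑' k, c k) * η ^ (2 / p))) := by
  refine (TimeSeries.integral_sum_sq_le (Finset.Subset.refl (Finset.range n))
    (v := fun k => c k * η ^ (2 / p)) (fun k => mul_nonneg (h.nonneg k) (by positivity))
    (W := fun j ω => f (pairs X j ω) - ∫ ω', f (pairs X 0 ω') ∂P)
    (fun j => (h.memLp_two (h.stat.memLp_comp hf hfp j)).sub (memLp_const _)) ?_).trans ?_
  · intro i k _
    have := h.cov_le k f f hf hf hfp hfp η hη hfη hfη
    rw [← h.stat.covariance_comp hf hf i k] at this
    unfold covariance at this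
    rwa [h.stat.integral_comp hf i, h.stat.integral_comp hf (i + k)] at this
  · rw [Finset.card_range, ← Finset.sum_mul]
    gcongr
    exact h.summ.sum_le_tsum _ fun k _ => h.nonneg k

omit [IsProbabilityMeasure P] in
lemma summable_cov {f g : ℝ × ℝ → ℝ} (hf : Measurable f) (hg : Measurable g)
    (hfp : MemLp (fun ω => f (pairs X 0 ω)) (ENNReal.ofReal p) P)
    (hgp : MemLp (fun ω => g (pairs X 0 ω)) (ENNReal.ofReal p) P) :
    Summable fun k => cov[fun ω => f (pairs X 0 ω), fun ω => g (pairs X k ω); P] := by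
  have h1 : 0 ≤ ∫ ω, |f (pairs X 0 ω)| ^ p ∂P := integral_nonneg fun ω => by positivity
  have h2 : 0 ≤ ∫ ω, |g (pairs X 0 ω)| ^ p ∂P := integral_nonneg fun ω => by positivity
  exact Summable.of_norm_bounded (h.summ.mul_right _) fun k => h.cov_le k f g hf hg hfp hgp
    (∫ ω, |f (pairs X 0 ω)| ^ p ∂P + ∫ ω, |g (pairs X 0 ω)| ^ p ∂P + 1) (by positivity)
    (by linarith) (by linarith)

/-- The pair at `i` involves `X (i + 1)`; the mixing condition of `CovDecay` already allows for
this, so the coefficients are unchanged. Centring doubles the bound. -/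
lemma boundedMixing {f : ℝ × ℝ → ℝ} (hf : Measurable f) {b : ℝ} (hfb : ∀ z, |f z| ≤ b) :
    BoundedMixing (fun j ω => f (pairs X j ω) - ∫ ω', f (pairs X 0 ω') ∂P) P (2 * b) a
      (fun k => cov[fun ω => f (pairs X 0 ω), fun ω => f (pairs X k ω); P]) where
  meas j := (hf.comp (measurable_pairs h.meas j)).sub_const _
  bound j ω := by
    have h1 : |∫ ω', f (pairs X 0 ω') ∂P| ≤ b := by
      simpa using norm_integral_le_of_norm_le_const (μ := P)
        (f := fun ω => f (pairs X 0 ω)) (ae_of_all _ fun ω => hfb (pairs X 0 ω))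
    refine (abs_sub _ _).trans ?_
    linarith [hfb (pairs X j ω)]
  mean j := by
    have hi : Integrable (fun ω => f (pairs X j ω)) P := (memLp_of_abs_le
      (hf.comp (measurable_pairs h.meas j)) (fun ω => hfb _) 1).integrable le_rfl
    rw [integral_sub hi (integrable_const _), h.stat.integral_comp hf j]
    simp
  cov i k := by
    rw [← h.stat.covariance_comp hf hf i k]
    unfold covariance
    rw [h.stat.integral_comp hf i, h.stat.integral_comp hf (i + k)]
  mix i k := by
    refine (h.mix i k).mono ?_ ?_ le_rfl
    · refine iSup₂_le fun j hj => Measurable.comap_le ?_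
      exact (hf.comp ((measurable_past X (by omega)).prodMk
        (measurable_past X (by omega)))).sub_const _
    · refine iSup₂_le fun j hj => Measurable.comap_le ?_
      exact (hf.comp ((measurable_future X hj).prodMk
        (measurable_future X (by omega)))).sub_const _
  anti := h.anti
  summ := h.summ_a

lemma tendsto_covariance_cut {g : ℝ × ℝ → ℝ} (hg : Measurable g)
    (hgp : MemLp (fun ω => g (pairs X 0 ω)) (ENNReal.ofReal p) P) (k : ℕ) :
    Tendsto (fun N : ℕ => cov[fun ω => cut N (g (pairs X 0 ω)),
        fun ω => cut N (g (pairs X k ω)); P]) atTop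
      (𝓝 cov[fun ω => g (pairs X 0 ω), fun ω => g (pairs X k ω); P]) := by
  have L : ∀ k, MemLp (fun ω => g (pairs X k ω)) 2 P := fun k =>
    h.memLp_two (h.stat.memLp_comp hg hgp k)
  have mc : ∀ (N : ℕ) k, Measurable fun ω => cut N (g (pairs X k ω)) := fun N k =>
    (measurable_cut N).comp (hg.comp (measurable_pairs h.meas k))
  have Lc : ∀ (N : ℕ) k, MemLp (fun ω => cut N (g (pairs X k ω))) 2 P := fun N k =>
    memLp_of_abs_le (mc N k) (fun ω => abs_cut_le N.cast_nonneg _) 2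
  have h1 : ∀ k, Tendsto (fun N : ℕ => ∫ ω, cut N (g (pairs X k ω)) ∂P) atTop
      (𝓝 (∫ ω, g (pairs X k ω) ∂P)) := fun k =>
    tendsto_integral_of_dominated_convergence (fun ω => |g (pairs X k ω)|)
      (fun N => (mc N k).aestronglyMeasurable) ((L k).integrable one_le_two).abs
      (fun N => ae_of_all _ fun ω => abs_cut_le_abs _ _) (ae_of_all _ fun ω => tendsto_cut _)
  have h2 : Tendsto (fun N : ℕ => ∫ ω, cut N (g (pairs X 0 ω)) * cut N (g (pairs X k ω)) ∂P) atTop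
      (𝓝 (∫ ω, g (pairs X 0 ω) * g (pairs X k ω) ∂P)) :=
    tendsto_integral_of_dominated_convergence (fun ω => |g (pairs X 0 ω) * g (pairs X k ω)|)
      (fun N => ((mc N 0).mul (mc N k)).aestronglyMeasurable) ((L 0).integrable_mul (L k)).abs
      (fun N => ae_of_all _ fun ω => by
        rw [norm_mul, abs_mul]
        exact mul_le_mul (abs_cut_le_abs _ _) (abs_cut_le_abs _ _) (abs_nonneg _) (abs_nonneg _))
      (ae_of_all _ fun ω => (tendsto_cut _).mul (tendsto_cut _))
  simp_rw [fun N => covariance_eq_sub (Lc N 0) (Lc N k), covariance_eq_sub (L 0) (L k)]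
  exact h2.sub ((h1 0).mul (h1 k))

/-- Dominated convergence for the series: truncation does not increase the p-th absolute moment, so
one multiple of `c` dominates the covariances at every level `N`. -/
lemma tendsto_longRunVar_cut {g : ℝ × ℝ → ℝ} (hg : Measurable g)
    (hgp : MemLp (fun ω => g (pairs X 0 ω)) (ENNReal.ofReal p) P) :
    Tendsto (fun N : ℕ => longRunVar fun k => cov[fun ω => cut N (g (pairs X 0 ω)),
        fun ω => cut N (g (pairs X k ω)); P]) atTop
      (𝓝 (longRunVar fun k => cov[fun ω => g (pairs X 0 ω), fun ω => g (pairs X k ω); P])) := by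
  have hI : 0 ≤ ∫ ω, |g (pairs X 0 ω)| ^ p ∂P := integral_nonneg fun ω => by positivity
  have mg := hg.comp (measurable_pairs h.meas 0)
  refine (h.tendsto_covariance_cut hg hgp 0).add (Tendsto.const_mul 2 ?_)
  refine tendsto_tsum_of_dominated_convergence
    (bound := fun k => c (k + 1) * (∫ ω, |g (pairs X 0 ω)| ^ p ∂P + 1) ^ (2 / p))
    (((summable_nat_add_iff 1).2 h.summ).mul_right _)
    (fun k => h.tendsto_covariance_cut hg hgp (k + 1)) (Eventually.of_forall fun N k => ?_)
  have hm : Measurable fun z => cut N (g z) := (measurable_cut N).comp hg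
  have hcp : MemLp (fun ω => cut N (g (pairs X 0 ω))) (ENNReal.ofReal p) P :=
    hgp.mono ((measurable_cut N).comp mg).aestronglyMeasurable
      (ae_of_all _ fun ω => abs_cut_le_abs _ _)
  have hle : ∫ ω, |cut N (g (pairs X 0 ω))| ^ p ∂P ≤ ∫ ω, |g (pairs X 0 ω)| ^ p ∂P + 1 := by
    have := integral_mono (h.integrable_rpow hcp) (h.integrable_rpow hgp)
      (fun ω => Real.rpow_le_rpow (abs_nonneg _) (abs_cut_le_abs N _) h.pos.le)
    linarith
  exact h.cov_le (k + 1) _ _ hm hm hcp hcp _ (by positivity) hle hle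

omit [IsProbabilityMeasure P] in
lemma tendsto_integral_sub_cut {g : ℝ × ℝ → ℝ} (hg : Measurable g)
    (hgp : MemLp (fun ω => g (pairs X 0 ω)) (ENNReal.ofReal p) P) :
    Tendsto (fun N : ℕ => ∫ ω, |g (pairs X 0 ω) - cut N (g (pairs X 0 ω))| ^ p ∂P) atTop
      (𝓝 0) := by
  have mg := hg.comp (measurable_pairs h.meas 0)
  rw [← integral_zero Ω ℝ (μ := P)]
  refine tendsto_integral_of_dominated_convergence (fun ω => |g (pairs X 0 ω)| ^ p)
    (fun N => ?_) (h.integrable_rpow hgp) (fun N => ae_of_all _ fun ω => ?_)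
    (ae_of_all _ fun ω => ?_)
  · have : Measurable fun ω => |g (pairs X 0 ω) - cut N (g (pairs X 0 ω))| :=
      (mg.sub ((measurable_cut N).comp mg)).norm
    exact (this.pow_const p).aestronglyMeasurable
  · rw [Real.norm_of_nonneg (by positivity)]
    exact Real.rpow_le_rpow (abs_nonneg _) (abs_sub_cut_le_abs _ _) h.pos.le
  · have h1 : Tendsto (fun N : ℕ => |g (pairs X 0 ω) - cut N (g (pairs X 0 ω))|) atTop (𝓝 0) := by
      have := ((tendsto_const_nhds (x := g (pairs X 0 ω))).sub (tendsto_cut (g (pairs X 0 ω)))).abs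
      simpa using this
    have := h1.rpow_const (p := p) (Or.inr h.pos.le)
    rwa [Real.zero_rpow h.pos.ne'] at this

/-- Central limit theorem for functions of pairs of successive variables. -/
theorem tendsto_charFun {g : ℝ × ℝ → ℝ} (hg : Measurable g)
    (hgp : MemLp (fun ω => g (pairs X 0 ω)) (ENNReal.ofReal p) P)
    (hg0 : ∫ ω, g (pairs X 0 ω) ∂P = 0) (t : ℝ) :
    Tendsto (fun n : ℕ => ∫ ω, Complex.exp
        ((t * ((√n)⁻¹ * ∑ j ∈ Finset.range n, g (pairs X j ω)) : ℝ) * Complex.I) ∂P) atTop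
      (𝓝 (Complex.exp (-(((longRunVar fun k =>
        cov[fun ω => g (pairs X 0 ω), fun ω => g (pairs X k ω); P] : ℝ) : ℂ) * t ^ 2 / 2)))) := by
  set m : ℕ → ℝ := fun N => ∫ ω, cut N (g (pairs X 0 ω)) ∂P with hm
  have mg := hg.comp (measurable_pairs h.meas 0)
  -- Interchange of limits needs three facts: approximation as `N → ∞` uniformly in `n`, the bounded
  -- theorem at each fixed `N`, and convergence of the Gaussian limits.
  refine TendstoUniformlyOnFilter.tendsto_of_eventually_tendsto (p := (atTop : Filter ℕ))
    (F := fun (N n : ℕ) => ∫ ω, Complex.exp ((t * ((√(n : ℝ))⁻¹ * ∑ j ∈ Finset.range n,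
      (cut N (g (pairs X j ω)) - m N)) : ℝ) * Complex.I) ∂P)
    (L := fun N => Complex.exp (-(((longRunVar fun k => cov[fun ω => cut N (g (pairs X 0 ω)),
        fun ω => cut N (g (pairs X k ω)); P] : ℝ) : ℂ) * t ^ 2 / 2))) ?_ ?_ ?_
  -- The summand `1/(N+1)` only makes the moment bound strictly positive, as `cov_le` requires.
  · set η : ℕ → ℝ := fun N => ∫ ω, |g (pairs X 0 ω) - cut N (g (pairs X 0 ω))| ^ p ∂P
      + 1 / ((N : ℝ) + 1) with hη
    have hη0 : ∀ N, 0 < η N := fun N => by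
      have : 0 ≤ ∫ ω, |g (pairs X 0 ω) - cut N (g (pairs X 0 ω))| ^ p ∂P :=
        integral_nonneg fun ω => by positivity
      positivity
    have hηlim : Tendsto η atTop (𝓝 0) := by
      simpa [hη] using (h.tendsto_integral_sub_cut hg hgp).add
        (tendsto_one_div_add_atTop_nhds_zero_nat (𝕜 := ℝ))
    have hblim : Tendsto (fun N => |t| * √(2 * ((∑' k, c k) * η N ^ (2 / p)))) atTop (𝓝 0) := by
      have h2p : 0 < 2 / p := div_pos two_pos h.pos
      have h1 := hηlim.rpow_const (p := 2 / p) (Or.inr h2p.le)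
      rw [Real.zero_rpow h2p.ne'] at h1
      have := (((h1.const_mul (∑' k, c k)).const_mul 2).sqrt).const_mul |t|
      simpa using this
    rw [Metric.tendstoUniformlyOnFilter_iff]
    intro ε hε
    have hev := (hblim.eventually (gt_mem_nhds hε)).prod_inl (atTop : Filter ℕ)
    refine hev.mono fun ⟨N, n⟩ hN => ?_
    simp only at hN ⊢
    rw [dist_eq_norm]
    refine lt_of_le_of_lt ?_ hN
    set f : ℝ × ℝ → ℝ := fun z => g z - cut N (g z) with hf
    have mf : Measurable f := hg.sub ((measurable_cut N).comp hg)
    have hfp : MemLp (fun ω => f (pairs X 0 ω)) (ENNReal.ofReal p) P :=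
      hgp.mono (mf.comp (measurable_pairs h.meas 0)).aestronglyMeasurable
        (ae_of_all _ fun ω => abs_sub_cut_le_abs _ _)
    have hf0 : ∫ ω, f (pairs X 0 ω) ∂P = - m N := by
      have i1 : Integrable (fun ω => g (pairs X 0 ω)) P := (h.memLp_two hgp).integrable one_le_two
      have i2 : Integrable (fun ω => cut N (g (pairs X 0 ω))) P :=
        (memLp_of_abs_le ((measurable_cut N).comp mg)
          (fun ω => abs_cut_le N.cast_nonneg _) 1).integrable le_rfl
      simp only [hf]
      rw [integral_sub i1 i2, hg0, zero_sub]
    have hηN : ∫ ω, |f (pairs X 0 ω)| ^ p ∂P ≤ η N :=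
      le_add_of_nonneg_right (by positivity)
    have hsq := h.integral_sum_sub_sq_le mf hfp (hη0 N) hηN n
    have hdiff : ∀ ω, (√n)⁻¹ * ∑ j ∈ Finset.range n, g (pairs X j ω)
        - (√n)⁻¹ * ∑ j ∈ Finset.range n, (cut N (g (pairs X j ω)) - m N)
        = (√n)⁻¹ * ∑ j ∈ Finset.range n, (f (pairs X j ω) - ∫ ω', f (pairs X 0 ω') ∂P) := by
      intro ω
      rw [← mul_sub, ← Finset.sum_sub_distrib, hf0]
      congr 1
      exact Finset.sum_congr rfl fun j _ => by simp only [hf]; ring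
    have mgj : ∀ j, Measurable fun ω => g (pairs X j ω) := fun j =>
      hg.comp (measurable_pairs h.meas j)
    have mcj : ∀ j, Measurable fun ω => cut N (g (pairs X j ω)) := fun j =>
      (measurable_cut N).comp (mgj j)
    have LD : MemLp (fun ω => (√n)⁻¹ * ∑ j ∈ Finset.range n,
        (f (pairs X j ω) - ∫ ω', f (pairs X 0 ω') ∂P)) 2 P :=
      (memLp_finsetSum _ fun j _ => (h.memLp_two (h.stat.memLp_comp mf hfp j)).sub
        (memLp_const _)).const_mul _
    refine (norm_integral_exp_sub_le
      ((Finset.measurable_fun_sum _ fun j _ => mgj j).const_mul _)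
      ((Finset.measurable_fun_sum _ fun j _ =>
        (mcj j).sub_const _).const_mul _) ?_ t).trans
          (mul_le_mul_of_nonneg_left (Real.sqrt_le_sqrt ?_) (abs_nonneg t))
    · exact (memLp_congr_ae (ae_of_all _ hdiff)).2 LD
    · rw [integral_congr_ae (ae_of_all _ fun ω => congrArg (· ^ 2) (hdiff ω))]
      simp_rw [mul_pow]
      rw [integral_const_mul]
      calc _ ≤ ((√n)⁻¹) ^ 2 * (n * (2 * ((∑' k, c k) * η N ^ (2 / p)))) := by gcongr
        _ = (n : ℝ)⁻¹ * n * (2 * ((∑' k, c k) * η N ^ (2 / p))) := by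
          rw [inv_pow, Real.sq_sqrt n.cast_nonneg]; ring
        _ ≤ 1 * (2 * ((∑' k, c k) * η N ^ (2 / p))) := by
          have : 0 ≤ ∑' k, c k := tsum_nonneg h.nonneg
          have := (hη0 N).le
          gcongr
          exact inv_mul_le_one
        _ = _ := one_mul _
  · refine Eventually.of_forall fun N => ?_
    exact (h.boundedMixing ((measurable_cut N).comp hg)
      (fun z => abs_cut_le N.cast_nonneg (g z))).tendsto_charFun t
  · refine (Complex.continuous_exp.tendsto _).comp (Tendsto.neg ?_)
    exact (((Complex.continuous_ofReal.tendsto _).comp (h.tendsto_longRunVar_cut hg hgp)).mul_const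
      _).div_const _

/-- Characteristic functions have modulus at most 1, hence so does the limit `e^{-σ²/2}` at `t = 1`.
-/
lemma longRunVar_nonneg {g : ℝ × ℝ → ℝ} (hg : Measurable g)
    (hgp : MemLp (fun ω => g (pairs X 0 ω)) (ENNReal.ofReal p) P)
    (hg0 : ∫ ω, g (pairs X 0 ω) ∂P = 0) :
    0 ≤ longRunVar fun k => cov[fun ω => g (pairs X 0 ω), fun ω => g (pairs X k ω); P] := by
  have h1 := (h.tendsto_charFun hg hgp hg0 1).norm
  have h2 := le_of_tendsto' h1 (b := 1) fun n => by
    simpa using norm_integral_le_of_norm_le_const (μ := P)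
      (ae_of_all _ fun ω => (Complex.norm_exp_ofReal_mul_I (1 * ((√(n : ℝ))⁻¹ *
        ∑ j ∈ Finset.range n, g (pairs X j ω)))).le)
  rw [Complex.norm_exp, Real.exp_le_one_iff] at h2
  simp at h2
  linarith

end CovDecay

end GeneralCLT

/-! ### The two dependence hypotheses imply covariance decay -/

section MixingCoefficients

variable {Ω : Type*} [MeasurableSpace Ω] {P : Measure Ω} [IsProbabilityMeasure P] {X : ℕ → Ω → ℝ}

lemma alphaLE_one (m₁ m₂ : MeasurableSpace Ω) : AlphaLE P m₁ m₂ 1 := fun A B _ _ => by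
  have h1 : P.real (A ∩ B) ≤ 1 := measureReal_le_one
  have h2 : P.real A * P.real B ≤ 1 := mul_le_one₀ measureReal_le_one measureReal_nonneg
    measureReal_le_one
  have h3 : 0 ≤ P.real (A ∩ B) := measureReal_nonneg
  have h4 : 0 ≤ P.real A * P.real B := mul_nonneg measureReal_nonneg measureReal_nonneg
  exact abs_le.2 ⟨by linarith, by linarith⟩

lemma bddAbove_alphaCoeff (X : ℕ → Ω → ℝ) (n : ℕ) :
    BddAbove {x : ℝ | ∃ (k : ℕ) (A B : Set Ω), MeasurableSet[past X k] A ∧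
      MeasurableSet[future X (k + n)] B ∧ x = |P.real (A ∩ B) - P.real A * P.real B|} := by
  refine ⟨1, ?_⟩
  rintro x ⟨k, A, B, hA, hB, rfl⟩
  exact alphaLE_one _ _ A B hA hB

lemma alphaLE_alphaCoeff (X : ℕ → Ω → ℝ) (i k : ℕ) :
    AlphaLE P (past X i) (future X (i + k)) (alphaCoeff X P k) := fun A B hA hB =>
  le_csSup (bddAbove_alphaCoeff X k) ⟨i, A, B, hA, hB, rfl⟩

lemma alphaCoeff_nonneg (X : ℕ → Ω → ℝ) (k : ℕ) : 0 ≤ alphaCoeff X P k :=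
  (alphaLE_alphaCoeff X 0 k).nonneg

omit [IsProbabilityMeasure P] in
lemma alphaCoeff_le {n : ℕ} {a : ℝ} (h : ∀ k, AlphaLE P (past X k) (future X (k + n)) a) :
    alphaCoeff X P n ≤ a := by
  refine csSup_le ⟨_, 0, ∅, ∅, @MeasurableSet.empty _ (past X 0),
    @MeasurableSet.empty _ (future X (0 + n)), rfl⟩ ?_
  rintro x ⟨k, A, B, hA, hB, rfl⟩
  exact h k A B hA hB

omit [MeasurableSpace Ω] in
lemma future_anti (X : ℕ → Ω → ℝ) : Antitone (future X) := fun _ _ hkl =>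
  iSup₂_le fun i hi => le_iSup₂_of_le i (hkl.trans hi) le_rfl

lemma alphaCoeff_anti (X : ℕ → Ω → ℝ) : Antitone (alphaCoeff X P) := fun m n hmn =>
  alphaCoeff_le fun k => (alphaLE_alphaCoeff X k m).mono le_rfl (future_anti X (by omega)) le_rfl

lemma alphaCoeff_le_one (X : ℕ → Ω → ℝ) (n : ℕ) : alphaCoeff X P n ≤ 1 :=
  alphaCoeff_le fun _ => alphaLE_one _ _

/-- Bounds for the mixing coefficients of the sequence of pairs of successive variables. -/
noncomputable def pairCoeff (X : ℕ → Ω → ℝ) (P : Measure Ω) : ℕ → ℝ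
  | 0 => 1
  | k + 1 => alphaCoeff X P k

lemma alphaLE_pairCoeff (X : ℕ → Ω → ℝ) (i k : ℕ) :
    AlphaLE P (past X (i + 1)) (future X (i + k)) (pairCoeff X P k) := by
  cases k with
  | zero => exact alphaLE_one _ _
  | succ k =>
    exact (alphaLE_alphaCoeff X (i + 1) k).mono le_rfl (future_anti X (by omega)) le_rfl

lemma pairCoeff_nonneg (X : ℕ → Ω → ℝ) (k : ℕ) : 0 ≤ pairCoeff X P k :=
  (alphaLE_pairCoeff X 0 k).nonneg

lemma pairCoeff_anti (X : ℕ → Ω → ℝ) : Antitone (pairCoeff X P) :=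
  antitone_nat_of_succ_le fun k => by
    cases k with
    | zero => exact alphaCoeff_le_one X 0
    | succ k => exact alphaCoeff_anti X (Nat.le_succ k)

lemma MDependent.alphaCoeff_eq_zero {m n : ℕ} (h : MDependent X P m) (hn : m + 1 ≤ n) :
    alphaCoeff X P n = 0 := by
  refine le_antisymm (alphaCoeff_le fun k A B hA hB => ?_) (alphaCoeff_nonneg X n)
  have := (Indep_iff _ _ _).1 (h k) A B hA (future_anti X (by omega) B hB)
  rw [measureReal_def, this, ENNReal.toReal_mul]
  simp [measureReal_def]

/-- Second moments suffice because only finitely many covariances can be nonzero. The pair at 0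
reaches index 1, so independence starts at lag `1 + m + 1`. -/
lemma MDependent.covDecay {m : ℕ} (h : MDependent X P m) (hX : ∀ i, Measurable (X i))
    (hs : StrictlyStationary X P) :
    CovDecay X P 2 (pairCoeff X P) (fun k => if k < m + 2 then 1 else 0) where
  meas := hX
  stat := hs
  two_le := le_rfl
  nonneg k := by positivity
  summ := summable_of_ne_finset_zero (s := Finset.range (m + 2)) fun k hk => by
    rw [if_neg (by simpa using hk)]
  cov_le k f g hf hg hfp hgp η hη hfη hgη := by
    rw [show ENNReal.ofReal 2 = 2 by simp] at hfp hgp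
    have hgk := hs.memLp_comp hg hgp k
    split_ifs with hk
    · refine (abs_cov_le_add_integral_sq hfp hgk).trans ?_
      have e : ∫ ω, g (pairs X k ω) ^ 2 ∂P = ∫ ω, g (pairs X 0 ω) ^ 2 ∂P :=
        hs.integral_comp (hg.pow_const 2) k
      simp only [Real.rpow_two, sq_abs] at hfη hgη
      rw [e, div_self two_ne_zero, Real.rpow_one]
      linarith
    · have hi : Indep (past X 1) (future X k) P :=
        indep_of_indep_of_le_right (h 1) (future_anti X (by omega))
      have hif : IndepFun (fun ω => f (pairs X 0 ω)) (fun ω => g (pairs X k ω)) P :=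
        indep_of_indep_of_le_left (indep_of_indep_of_le_right hi
          (hg.comp ((measurable_future X le_rfl).prodMk
            (measurable_future X (Nat.le_succ k)))).comap_le)
          (hf.comp ((measurable_past X zero_le_one).prodMk (measurable_past X le_rfl))).comap_le
      rw [hif.covariance_eq_zero hfp hgk]
      simp
  mix := alphaLE_pairCoeff X
  anti := pairCoeff_anti X
  summ_a := summable_of_ne_finset_zero (s := Finset.range (m + 2)) fun k hk => by
    obtain ⟨l, rfl⟩ : ∃ l, k = l + 1 := ⟨k - 1, by simp at hk; omega⟩
    exact h.alphaCoeff_eq_zero (by simp at hk; omega)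

/-- Davydov's inequality with `p = 2 + δ`, for which `1 - 2/p = δ/(2+δ)`. That inequality requires a
positive coefficient, hence the added `(1/2)^k`; subadditivity of the power keeps the series
summable. The coefficients themselves are summable because they lie in `[0, 1]`, where a power with
exponent at most 1 can only increase them. -/
lemma covDecay_of_summable {δ : ℝ} (hδ : 0 < δ) (hX : ∀ i, Measurable (X i))
    (hs : StrictlyStationary X P)
    (ha : Summable fun n : ℕ => alphaCoeff X P (n + 1) ^ (δ / (2 + δ))) :
    CovDecay X P (2 + δ) (pairCoeff X P)
      (fun k => 9 * (pairCoeff X P k + (1 / 2) ^ k) ^ (δ / (2 + δ))) where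
  meas := hX
  stat := hs
  two_le := by linarith
  nonneg k := by
    have := pairCoeff_nonneg (P := P) X k
    positivity
  summ := by
    have hθ : 0 < δ / (2 + δ) := by positivity
    have hθ1 : δ / (2 + δ) ≤ 1 := div_le_one_of_le₀ (by linarith) (by linarith)
    -- The shift is 2 because `pairCoeff` at `n + 2` is `alphaCoeff` at `n + 1`, where the assumed
    -- series begins.
    have h1 : Summable fun k => pairCoeff X P k ^ (δ / (2 + δ)) :=
      (summable_nat_add_iff 2).1 ha
    have h2 : Summable fun k : ℕ => (((1 : ℝ) / 2) ^ (δ / (2 + δ))) ^ k :=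
      summable_geometric_of_lt_one (by positivity)
        (Real.rpow_lt_one (by norm_num) (by norm_num) hθ)
    refine ((h1.add h2).of_nonneg_of_le (fun k => ?_) fun k => ?_).mul_left 9
    · have := pairCoeff_nonneg (P := P) X k
      positivity
    · refine (Real.rpow_add_le_add_rpow (pairCoeff_nonneg X k) (by positivity) hθ.le hθ1).trans_eq
        ?_
      rw [← Real.rpow_natCast, ← Real.rpow_natCast, ← Real.rpow_mul (by norm_num),
        ← Real.rpow_mul (by norm_num), mul_comm (k : ℝ)]
  cov_le k f g hf hg hfp hgp η hη hfη hgη := by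
    have hp : (2 : ℝ) < 2 + δ := by linarith
    have e : 1 - 2 / (2 + δ) = δ / (2 + δ) := by field_simp; ring
    have hi : ∀ {u : Ω → ℝ}, MemLp u (ENNReal.ofReal (2 + δ)) P →
        Integrable (fun ω => |u ω| ^ (2 + δ)) P := fun hu => by
      have := hu.integrable_norm_rpow (by simp; linarith) ENNReal.ofReal_ne_top
      rwa [ENNReal.toReal_ofReal (by linarith)] at this
    have hmix := ((alphaLE_pairCoeff (P := P) X 0 k).mono le_rfl
      (future_anti X (zero_add k).le)
      (le_add_of_nonneg_right (by positivity : (0 : ℝ) ≤ (1 / 2) ^ k)))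
    have hpos := pairCoeff_nonneg (P := P) X k
    have hgk : ∫ ω, |g (pairs X k ω)| ^ (2 + δ) ∂P = ∫ ω, |g (pairs X 0 ω)| ^ (2 + δ) ∂P :=
      hs.integral_comp (f := fun z => |g z| ^ (2 + δ)) (hg.norm.pow_const _) k
    rw [← e]
    exact hmix.abs_cov_le_rpow (by positivity) (past_le hX _) (future_le hX _) hp hη
      (hf.comp ((measurable_past X zero_le_one).prodMk (measurable_past X le_rfl)))
      (hg.comp ((measurable_future X le_rfl).prodMk (measurable_future X (Nat.le_succ k))))
      (hi hfp) (hi (hs.memLp_comp hg hgp k)) hfη (hgk.trans_le hgη)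
  mix := alphaLE_pairCoeff X
  anti := pairCoeff_anti X
  summ_a := by
    have hθ1 : δ / (2 + δ) ≤ 1 := div_le_one_of_le₀ (by linarith) (by linarith)
    refine (summable_nat_add_iff 2).1 (ha.of_nonneg_of_le (fun n => alphaCoeff_nonneg X _)
      fun n => ?_)
    change alphaCoeff X P (n + 1) ≤ _
    rcases (alphaCoeff_nonneg (P := P) X (n + 1)).eq_or_lt with h0 | h0
    · rw [← h0]; positivity
    · exact Real.self_le_rpow_of_le_one h0.le (alphaCoeff_le_one X _) hθ1

end MixingCoefficients

/-! ### Algebra of the sample autocovariances -/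

section Algebra

/-- The sum of the lagged products about the mean. -/
lemma sum_sub_mean_mul_sub_mean (x : ℕ → ℝ) (k : ℕ) {m : ℝ}
    (hm : (k + 1) * m = ∑ i ∈ Finset.range (k + 1), x i) :
    ∑ i ∈ Finset.range k, (x i - m) * (x (i + 1) - m)
      = ∑ i ∈ Finset.range (k + 1), x i * x (i + 1) - x k * x (k + 1)
        - m * (2 * (k + 1) * m - x k - x 0) + k * m ^ 2 := by
  have h1 : ∑ i ∈ Finset.range k, x i = (k + 1) * m - x k := by
    rw [hm, Finset.sum_range_succ]; ring
  have h2 : ∑ i ∈ Finset.range k, x (i + 1) = (k + 1) * m - x 0 := by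
    rw [hm, Finset.sum_range_succ']; ring
  have h3 : ∀ i, (x i - m) * (x (i + 1) - m) = x i * x (i + 1) - m * x i - m * x (i + 1) + m ^ 2 :=
    fun i => by ring
  simp_rw [h3]
  rw [Finset.sum_add_distrib, Finset.sum_sub_distrib, Finset.sum_sub_distrib, ← Finset.mul_sum,
    ← Finset.mul_sum, h1, h2, Finset.sum_range_succ]
  simp only [Finset.sum_const, Finset.card_range, nsmul_eq_mul]
  ring

lemma sum_sub_mean_sq (x : ℕ → ℝ) (n : ℕ) {m : ℝ} (hm : n * m = ∑ i ∈ Finset.range n, x i) :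
    ∑ i ∈ Finset.range n, (x i - m) ^ 2 = ∑ i ∈ Finset.range n, x i ^ 2 - n * m ^ 2 := by
  simp_rw [sub_sq]
  rw [Finset.sum_add_distrib, Finset.sum_sub_distrib, ← Finset.sum_mul, ← Finset.mul_sum, ← hm]
  simp only [Finset.sum_const, Finset.card_range, nsmul_eq_mul]
  ring

/-- Replacing the sample autocovariances by averages of products costs little. -/
lemma abs_autocov_remainder_le (x : ℕ → ℝ) (k : ℕ) {m : ℝ} (ρ : ℝ)
    (hm : (k + 1) * m = ∑ i ∈ Finset.range (k + 1), x i) :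
    |(1 / (k + 1 : ℝ)) * ∑ i ∈ Finset.range k, (x i - m) * (x (i + 1) - m)
        - ρ * ((1 / (k + 1 : ℝ)) * ∑ i ∈ Finset.range (k + 1), (x i - m) ^ 2)
        - (1 / (k + 1 : ℝ)) * ∑ i ∈ Finset.range (k + 1), (x i * x (i + 1) - ρ * x i ^ 2)|
      ≤ (2 * x k ^ 2 + x (k + 1) ^ 2 + x 0 ^ 2) / (k + 1) + (4 + |ρ|) * m ^ 2 := by
  have hn : (0 : ℝ) < k + 1 := by positivity
  have h2 := sum_sub_mean_sq x (k + 1) (m := m) (by push_cast; exact hm)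
  push_cast at h2
  rw [sum_sub_mean_mul_sub_mean x k hm, h2, Finset.sum_sub_distrib, ← Finset.mul_sum]
  -- The full sums cancel; boundary terms divided by the sample size and a multiple of `m²` remain.
  have e : (1 / (k + 1 : ℝ)) * (∑ i ∈ Finset.range (k + 1), x i * x (i + 1) - x k * x (k + 1)
        - m * (2 * (k + 1) * m - x k - x 0) + k * m ^ 2)
        - ρ * ((1 / (k + 1 : ℝ)) * (∑ i ∈ Finset.range (k + 1), x i ^ 2 - (k + 1) * m ^ 2))
        - (1 / (k + 1 : ℝ)) * (∑ i ∈ Finset.range (k + 1), x i * x (i + 1)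
          - ρ * ∑ i ∈ Finset.range (k + 1), x i ^ 2)
      = (-(x k * x (k + 1)) + m * x k + m * x 0 - m ^ 2) / (k + 1) + (ρ - 1) * m ^ 2 := by
    field_simp
    ring
  rw [e]
  refine (abs_add_le _ _).trans ?_
  have hm2 := sq_nonneg m
  have h3 : |(ρ - 1) * m ^ 2| ≤ (|ρ| + 1) * m ^ 2 := by
    rw [abs_mul, abs_of_nonneg hm2]
    gcongr
    exact (abs_sub ρ 1).trans (by simp)
  have h4 : |-(x k * x (k + 1)) + m * x k + m * x 0 - m ^ 2|
      ≤ 2 * x k ^ 2 + x (k + 1) ^ 2 + x 0 ^ 2 + 3 * m ^ 2 := by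
    rw [abs_le]
    constructor <;>
      nlinarith [sq_nonneg (x k - x (k + 1)), sq_nonneg (x k + x (k + 1)), sq_nonneg (m - x k),
        sq_nonneg (m + x k), sq_nonneg (m - x 0), sq_nonneg (m + x 0), sq_nonneg (x k),
        sq_nonneg (x (k + 1)), sq_nonneg (x 0)]
  rw [abs_div, abs_of_pos hn]
  calc _ ≤ (2 * x k ^ 2 + x (k + 1) ^ 2 + x 0 ^ 2 + 3 * m ^ 2) / (k + 1)
        + (|ρ| + 1) * m ^ 2 := by gcongr
    _ ≤ (2 * x k ^ 2 + x (k + 1) ^ 2 + x 0 ^ 2) / (k + 1) + 3 * m ^ 2 + (|ρ| + 1) * m ^ 2 := by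
      rw [add_div _ (3 * m ^ 2)]
      gcongr
      exact div_le_self (by positivity) (by simp)
    _ = _ := by ring

end Algebra

/-! ### The score: moments, long-run variance, central limit theorem -/

section Autocorrelation

variable {Ω : Type*} [MeasurableSpace Ω] {P : Measure Ω} [IsProbabilityMeasure P]
  {X : ℕ → Ω → ℝ} {p : ℝ} {a c : ℕ → ℝ}

/-- Markov's inequality for the majorant; `f` itself need not be measurable. -/
lemma tendstoInMeasure_zero_of_le {f G : ℕ → Ω → ℝ} {u : ℕ → ℝ} (hG : ∀ n, Integrable (G n) P)
    (hfG : ∀ᶠ n in atTop, ∀ ω, |f n ω| ≤ G n ω) (hGu : ∀ᶠ n in atTop, ∫ ω, G n ω ∂P ≤ u n)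
    (hu : Tendsto u atTop (𝓝 0)) : TendstoInMeasure P f atTop 0 := by
  rw [tendstoInMeasure_iff_measureReal_norm]
  intro ε hε
  have h0 : Tendsto (fun n => u n / ε) atTop (𝓝 0) := by simpa using hu.div_const ε
  refine squeeze_zero' (Eventually.of_forall fun _ => measureReal_nonneg) ?_ h0
  filter_upwards [hfG, hGu] with n h1 h2
  have h3 := mul_meas_ge_le_integral_of_nonneg
    (ae_of_all P fun ω => (abs_nonneg _).trans (h1 ω)) (hG n) ε
  rw [le_div_iff₀ hε, mul_comm]
  refine le_trans ?_ (h3.trans h2)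
  refine mul_le_mul_of_nonneg_left (measureReal_mono fun ω hω => le_trans ?_ (h1 ω)) hε.le
  simpa using hω

/-- The centred first variable of a pair. -/
def devFun (μ : ℝ) (z : ℝ × ℝ) : ℝ := z.1 - μ

/-- The product of the centred variables of a pair. -/
def prodFun (μ : ℝ) (z : ℝ × ℝ) : ℝ := (z.1 - μ) * (z.2 - μ)

/-- The square of the centred first variable of a pair. -/
def sqFun (μ : ℝ) (z : ℝ × ℝ) : ℝ := (z.1 - μ) ^ 2

lemma measurable_devFun (μ : ℝ) : Measurable (devFun μ) := by unfold devFun; fun_prop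
lemma measurable_prodFun (μ : ℝ) : Measurable (prodFun μ) := by unfold prodFun; fun_prop
lemma measurable_sqFun (μ : ℝ) : Measurable (sqFun μ) := by unfold sqFun; fun_prop

omit [IsProbabilityMeasure P] in
lemma lagProd_eq (X : ℕ → Ω → ℝ) (i : ℕ) :
    lagProd X P i = fun ω => prodFun (∫ ω', X 0 ω' ∂P) (pairs X i ω) := rfl

omit [IsProbabilityMeasure P] in
lemma centredSq_eq (X : ℕ → Ω → ℝ) (i : ℕ) :
    centredSq X P i = fun ω => sqFun (∫ ω', X 0 ω' ∂P) (pairs X i ω) := rfl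

/-- The function of a pair whose averages govern the sample autocorrelation. -/
noncomputable def scoreFun (μ ρ V : ℝ) (z : ℝ × ℝ) : ℝ :=
  V⁻¹ * (prodFun μ z - ρ * sqFun μ z)

lemma measurable_scoreFun (μ ρ V : ℝ) : Measurable (scoreFun μ ρ V) :=
  ((measurable_prodFun μ).sub ((measurable_sqFun μ).const_mul ρ)).const_mul _

omit [MeasurableSpace Ω] in
lemma sampleMean_eq {n : ℕ} (hn : 0 < n) (μ : ℝ) (ω : Ω) :
    sampleMean X n ω = μ + (1 / (n : ℝ)) * ∑ i ∈ Finset.range n, (X i ω - μ) := by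
  have : (n : ℝ) ≠ 0 := by exact_mod_cast hn.ne'
  rw [sampleMean, Finset.sum_sub_distrib]
  simp only [Finset.sum_const, Finset.card_range, nsmul_eq_mul]
  field_simp
  ring

omit [IsProbabilityMeasure P] in
lemma measurable_sampleMean (hX : ∀ i, Measurable (X i)) (n : ℕ) :
    Measurable (sampleMean X n) :=
  (Finset.measurable_fun_sum _ fun i _ => hX i).const_mul _

/-- The first-order sample autocovariance. -/
noncomputable def sampleAutocov (X : ℕ → Ω → ℝ) (n : ℕ) (ω : Ω) : ℝ :=
  (1 / (n : ℝ)) * ∑ i ∈ Finset.range (n - 1),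
    (X i ω - sampleMean X n ω) * (X (i + 1) ω - sampleMean X n ω)

lemma measurable_sampleAutocov (hX : ∀ i, Measurable (X i)) (n : ℕ) :
    Measurable (sampleAutocov X n) :=
  (Finset.measurable_fun_sum _ fun i _ => ((hX i).sub (measurable_sampleMean hX n)).mul
    ((hX (i + 1)).sub (measurable_sampleMean hX n))).const_mul _

lemma measurable_sampleVar (hX : ∀ i, Measurable (X i)) (n : ℕ) :
    Measurable (sampleVar X n) :=
  (Finset.measurable_fun_sum _ fun i _ =>
    ((hX i).sub (measurable_sampleMean hX n)).pow_const 2).const_mul _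

namespace CovDecay

variable (h : CovDecay X P p a c) (hL : MemLp (X 0) (ENNReal.ofReal (2 * p)) P)
include h

lemma exists_integral_sum_sub_sq_le {f : ℝ × ℝ → ℝ} (hf : Measurable f)
    (hfp : MemLp (fun ω => f (pairs X 0 ω)) (ENNReal.ofReal p) P) :
    ∃ C : ℝ, 0 ≤ C ∧ ∀ n : ℕ, ∫ ω, (∑ j ∈ Finset.range n,
      (f (pairs X j ω) - ∫ ω', f (pairs X 0 ω') ∂P)) ^ 2 ∂P ≤ n * C := by
  have h1 : 0 ≤ ∫ ω, |f (pairs X 0 ω)| ^ p ∂P := integral_nonneg fun ω => by positivity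
  refine ⟨_, ?_, fun n => h.integral_sum_sub_sq_le hf hfp
    (η := ∫ ω, |f (pairs X 0 ω)| ^ p ∂P + 1) (by positivity) (by linarith) n⟩
  have : 0 ≤ ∑' k, c k := tsum_nonneg h.nonneg
  positivity

include hL

omit [IsProbabilityMeasure P] in
lemma memLp_all (i : ℕ) : MemLp (X i) (ENNReal.ofReal (2 * p)) P :=
  h.stat.memLp_comp measurable_fst hL i

lemma memLp_dev (i : ℕ) :
    MemLp (fun ω => X i ω - ∫ ω', X 0 ω' ∂P) (ENNReal.ofReal (2 * p)) P :=
  (h.memLp_all hL i).sub (memLp_const _)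

lemma memLp_devFun : MemLp (fun ω => devFun (∫ ω', X 0 ω' ∂P) (pairs X 0 ω))
    (ENNReal.ofReal p) P :=
  (h.memLp_dev hL 0).mono_exponent (ENNReal.ofReal_le_ofReal (by linarith [h.pos]))

/-- Hölder with `1/(2p) + 1/(2p) = 1/p`: this is where moments of order `2p` of the series are
spent. -/
lemma memLp_mul (i j : ℕ) : MemLp (fun ω => (X i ω - ∫ ω', X 0 ω' ∂P)
    * (X j ω - ∫ ω', X 0 ω' ∂P)) (ENNReal.ofReal p) P := by
  have : ENNReal.HolderTriple (ENNReal.ofReal (2 * p)) (ENNReal.ofReal (2 * p))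
      (ENNReal.ofReal p) := ⟨by
    have hp := h.pos
    rw [← ENNReal.ofReal_inv_of_pos (by positivity), ← ENNReal.ofReal_inv_of_pos hp,
      ← ENNReal.ofReal_add (by positivity) (by positivity)]
    congr 1
    field_simp
    norm_num⟩
  exact (h.memLp_dev hL j).mul' (h.memLp_dev hL i)

lemma memLp_prodFun : MemLp (fun ω => prodFun (∫ ω', X 0 ω' ∂P) (pairs X 0 ω))
    (ENNReal.ofReal p) P := h.memLp_mul hL 0 1

lemma memLp_sqFun : MemLp (fun ω => sqFun (∫ ω', X 0 ω' ∂P) (pairs X 0 ω))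
    (ENNReal.ofReal p) P := by
  simpa only [sqFun, pairs, sq] using h.memLp_mul hL 0 0

lemma memLp_scoreFun (ρ V : ℝ) :
    MemLp (fun ω => scoreFun (∫ ω', X 0 ω' ∂P) ρ V (pairs X 0 ω)) (ENNReal.ofReal p) P :=
  ((h.memLp_prodFun hL).sub ((h.memLp_sqFun hL).const_mul ρ)).const_mul _

lemma memLp_two_dev (i : ℕ) : MemLp (fun ω => X i ω - ∫ ω', X 0 ω' ∂P) 2 P :=
  (h.memLp_dev hL i).mono_exponent (by
    rw [show (2 : ENNReal) = ENNReal.ofReal 2 by simp]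
    exact ENNReal.ofReal_le_ofReal (by linarith [h.two_le]))

lemma integral_dev : ∫ ω, devFun (∫ ω', X 0 ω' ∂P) (pairs X 0 ω) ∂P = 0 := by
  have hi : Integrable (X 0) P :=
    (h.memLp_all hL 0).integrable (by
      rw [← ENNReal.ofReal_one]
      exact ENNReal.ofReal_le_ofReal (by linarith [h.two_le]))
  simp only [devFun, pairs]
  rw [integral_sub hi (integrable_const _)]
  simp

omit [IsProbabilityMeasure P] hL in
lemma integral_sqFun (i : ℕ) :
    ∫ ω, (X i ω - ∫ ω', X 0 ω' ∂P) ^ 2 ∂P = Var[X 0; P] := by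
  rw [variance_eq_integral (h.meas 0).aemeasurable]
  exact h.stat.integral_comp (measurable_sqFun _) i

omit [IsProbabilityMeasure P] hL in
lemma integral_prodFun :
    ∫ ω, prodFun (∫ ω', X 0 ω' ∂P) (pairs X 0 ω) ∂P = cov[X 0, X 1; P] := by
  have : ∫ ω, X 1 ω ∂P = ∫ ω, X 0 ω ∂P := h.stat.integral_comp measurable_fst 1
  rw [covariance, this]
  rfl

lemma integral_scoreFun (hV : 0 < Var[X 0; P]) :
    ∫ ω, scoreFun (∫ ω', X 0 ω' ∂P) (autocorr X P) (Var[X 0; P]) (pairs X 0 ω) ∂P = 0 := by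
  have i1 := (h.memLp_two (h.memLp_prodFun hL)).integrable one_le_two
  have i2 := (h.memLp_two (h.memLp_sqFun hL)).integrable one_le_two
  have e : ∫ ω, sqFun (∫ ω', X 0 ω' ∂P) (pairs X 0 ω) ∂P = Var[X 0; P] := h.integral_sqFun 0
  simp only [scoreFun]
  rw [integral_const_mul, integral_sub i1 (i2.const_mul _), integral_const_mul,
    h.integral_prodFun, e, autocorr, div_mul_cancel₀ _ hV.ne', sub_self, mul_zero]

lemma covariance_scoreFun (ρ V : ℝ) (k : ℕ) :
    cov[fun ω => scoreFun (∫ ω', X 0 ω' ∂P) ρ V (pairs X 0 ω),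
        fun ω => scoreFun (∫ ω', X 0 ω' ∂P) ρ V (pairs X k ω); P]
      = (1 / V ^ 2) * (cov[lagProd X P 0, lagProd X P k; P]
        - ρ * (cov[centredSq X P 0, lagProd X P k; P] + cov[lagProd X P 0, centredSq X P k; P])
        + ρ ^ 2 * cov[centredSq X P 0, centredSq X P k; P]) := by
  have L1 : ∀ k, MemLp (lagProd X P k) 2 P := fun k =>
    h.memLp_two (h.stat.memLp_comp (measurable_prodFun _) (h.memLp_prodFun hL) k)
  have L2 : ∀ k, MemLp (centredSq X P k) 2 P := fun k =>
    h.memLp_two (h.stat.memLp_comp (measurable_sqFun _) (h.memLp_sqFun hL) k)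
  have L3 : ∀ k, MemLp (fun ω => ρ * centredSq X P k ω) 2 P := fun k => (L2 k).const_mul ρ
  have e : ∀ k, (fun ω => scoreFun (∫ ω', X 0 ω' ∂P) ρ V (pairs X k ω))
      = fun ω => V⁻¹ * ((lagProd X P k) - fun ω => ρ * centredSq X P k ω) ω := fun k => rfl
  rw [e 0, e k, covariance_const_mul_left, covariance_const_mul_right,
    covariance_sub_sub (L1 0) (L3 0) (L1 k) (L3 k)]
  simp only [covariance_const_mul_left, covariance_const_mul_right]
  field_simp
  ring

omit [IsProbabilityMeasure P] hL in
lemma summable_cov_succ {f g : ℝ × ℝ → ℝ} (hf : Measurable f) (hg : Measurable g)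
    (hfp : MemLp (fun ω => f (pairs X 0 ω)) (ENNReal.ofReal p) P)
    (hgp : MemLp (fun ω => g (pairs X 0 ω)) (ENNReal.ofReal p) P) :
    Summable fun k => cov[fun ω => f (pairs X 0 ω), fun ω => g (pairs X (k + 1) ω); P] :=
  (summable_nat_add_iff 1).2 (h.summable_cov hf hg hfp hgp)

lemma summable_cov_lagProd_lagProd :
    Summable fun k => cov[lagProd X P 0, lagProd X P (k + 1); P] := by
  simp only [lagProd_eq]
  exact h.summable_cov_succ (measurable_prodFun _) (measurable_prodFun _) (h.memLp_prodFun hL)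
    (h.memLp_prodFun hL)

lemma summable_cov_centredSq_centredSq :
    Summable fun k => cov[centredSq X P 0, centredSq X P (k + 1); P] := by
  simp only [centredSq_eq]
  exact h.summable_cov_succ (measurable_sqFun _) (measurable_sqFun _) (h.memLp_sqFun hL)
    (h.memLp_sqFun hL)

lemma summable_cov_centredSq_lagProd :
    Summable fun k => cov[centredSq X P 0, lagProd X P (k + 1); P] := by
  simp only [lagProd_eq, centredSq_eq]
  exact h.summable_cov_succ (measurable_sqFun _) (measurable_prodFun _) (h.memLp_sqFun hL)
    (h.memLp_prodFun hL)

lemma summable_cov_lagProd_centredSq :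
    Summable fun k => cov[lagProd X P 0, centredSq X P (k + 1); P] := by
  simp only [lagProd_eq, centredSq_eq]
  exact h.summable_cov_succ (measurable_prodFun _) (measurable_sqFun _) (h.memLp_prodFun hL)
    (h.memLp_sqFun hL)

/-- Termwise bilinear expansion. The lag-0 cross covariance occurs twice, and each positive lag
carries a factor 2 with two cross covariances; so the mixed terms add up to `-2ρν`. -/
lemma longRunVar_scoreFun :
    (longRunVar fun k =>
      cov[fun ω => scoreFun (∫ ω', X 0 ω' ∂P) (autocorr X P) (Var[X 0; P]) (pairs X 0 ω),
        fun ω => scoreFun (∫ ω', X 0 ω' ∂P) (autocorr X P) (Var[X 0; P]) (pairs X k ω); P])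
      = gammaSq X P := by
  have s1 := h.summable_cov_lagProd_lagProd hL
  have s2 := h.summable_cov_centredSq_lagProd hL
  have s3 := h.summable_cov_lagProd_centredSq hL
  have s4 := h.summable_cov_centredSq_centredSq hL
  have L1 : AEMeasurable (lagProd X P 0) P :=
    ((measurable_prodFun (∫ ω', X 0 ω' ∂P)).comp (measurable_pairs h.meas 0)).aemeasurable
  have L2 : AEMeasurable (centredSq X P 0) P :=
    ((measurable_sqFun (∫ ω', X 0 ω' ∂P)).comp (measurable_pairs h.meas 0)).aemeasurable
  simp only [longRunVar, h.covariance_scoreFun hL]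
  rw [tsum_mul_left, (s1.sub ((s2.add s3).mul_left _)).tsum_add (s4.mul_left _),
    s1.tsum_sub ((s2.add s3).mul_left _), tsum_mul_left, tsum_mul_left, s2.tsum_add s3,
    gammaSq, tauSq, kappaSq, nu, ← covariance_self L1, ← covariance_self L2,
    covariance_comm (centredSq X P 0) (lagProd X P 0)]
  ring

lemma gammaSq_nonneg (hV : 0 < Var[X 0; P]) : 0 ≤ gammaSq X P := by
  rw [← h.longRunVar_scoreFun hL]
  exact h.longRunVar_nonneg (measurable_scoreFun _ _ _) (h.memLp_scoreFun hL _ _)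
    (h.integral_scoreFun hL hV)

/-- Central limit theorem for the score. -/
lemma tendstoInDistribution_score (hV : 0 < Var[X 0; P]) :
    TendstoInDistribution (fun (n : ℕ) (ω : Ω) => (√n)⁻¹ * ∑ j ∈ Finset.range n,
        scoreFun (∫ ω', X 0 ω' ∂P) (autocorr X P) (Var[X 0; P]) (pairs X j ω))
      atTop (id : ℝ → ℝ) (fun _ => P) (gaussianReal 0 (gammaSq X P).toNNReal) where
  forall_aemeasurable n := ((Finset.measurable_fun_sum _ fun j _ =>
    (measurable_scoreFun _ _ _).comp (measurable_pairs h.meas j)).const_mul _).aemeasurable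
  aemeasurable_limit := aemeasurable_id
  tendsto := by
    refine ProbabilityMeasure.tendsto_iff_tendsto_charFun.2 fun t => ?_
    have h1 := h.tendsto_charFun (measurable_scoreFun _ _ _) (h.memLp_scoreFun hL _ _)
      (h.integral_scoreFun hL hV) t
    rw [h.longRunVar_scoreFun hL] at h1
    simp only [ProbabilityMeasure.coe_mk, Measure.map_id, charFun_gaussianReal]
    -- Nonnegativity of `gammaSq` ensures that `toNNReal` does not alter the variance.
    have e : ((gammaSq X P).toNNReal : ℂ) = ((gammaSq X P : ℝ) : ℂ) :=
      congrArg Complex.ofReal (Real.coe_toNNReal _ (h.gammaSq_nonneg hL hV))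
    convert! h1 using 2
    · rw [charFun_apply_real, integral_map]
      · push_cast; rfl
      · exact ((Finset.measurable_fun_sum _ fun j _ =>
          (measurable_scoreFun _ _ _).comp (measurable_pairs h.meas j)).const_mul _).aemeasurable
      · fun_prop
    · rw [e]
      simp

end CovDecay

end Autocorrelation

/-! ### Consistency of the sample variance and Slutsky's argument -/

section Slutsky

variable {Ω : Type*} [MeasurableSpace Ω] {P : Measure Ω} [IsProbabilityMeasure P]
  {X : ℕ → Ω → ℝ} {p : ℝ} {a c : ℕ → ℝ}

namespace CovDecay

variable (h : CovDecay X P p a c)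
include h

/-- Averages have variance of order `1 / n`. -/
lemma exists_integral_average_sq_le {f : ℝ × ℝ → ℝ} (hf : Measurable f)
    (hfp : MemLp (fun ω => f (pairs X 0 ω)) (ENNReal.ofReal p) P) :
    ∃ C : ℝ, 0 ≤ C ∧ ∀ n : ℕ, ∫ ω, ((1 / (n : ℝ)) * ∑ j ∈ Finset.range n,
      (f (pairs X j ω) - ∫ ω', f (pairs X 0 ω') ∂P)) ^ 2 ∂P ≤ C / n := by
  obtain ⟨C, hC, hle⟩ := h.exists_integral_sum_sub_sq_le hf hfp
  refine ⟨C, hC, fun n => ?_⟩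
  simp_rw [mul_pow]
  rw [integral_const_mul]
  rcases Nat.eq_zero_or_pos n with rfl | hn
  · simp
  · have hn' : (0 : ℝ) < n := by exact_mod_cast hn
    calc _ ≤ (1 / (n : ℝ)) ^ 2 * (n * C) := by gcongr; exact hle n
      _ = C / n := by field_simp

lemma memLp_average {f : ℝ × ℝ → ℝ} (hf : Measurable f)
    (hfp : MemLp (fun ω => f (pairs X 0 ω)) (ENNReal.ofReal p) P) (n : ℕ) :
    MemLp (fun ω => (1 / (n : ℝ)) * ∑ j ∈ Finset.range n,
      (f (pairs X j ω) - ∫ ω', f (pairs X 0 ω') ∂P)) 2 P :=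
  (memLp_finsetSum _ fun j _ => (h.memLp_two (h.stat.memLp_comp hf hfp j)).sub
    (memLp_const _)).const_mul _

variable (hL : MemLp (X 0) (ENNReal.ofReal (2 * p)) P)
include hL

lemma exists_integral_mean_sq_le :
    ∃ C : ℝ, 0 ≤ C ∧ ∀ n : ℕ, ∫ ω, ((1 / (n : ℝ)) * ∑ j ∈ Finset.range n,
      (X j ω - ∫ ω', X 0 ω' ∂P)) ^ 2 ∂P ≤ C / n := by
  have := h.exists_integral_average_sq_le (measurable_devFun _) (h.memLp_devFun hL)
  rw [h.integral_dev hL] at this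
  simpa only [sub_zero, devFun, pairs] using this

lemma memLp_mean (n : ℕ) :
    MemLp (fun ω => (1 / (n : ℝ)) * ∑ j ∈ Finset.range n, (X j ω - ∫ ω', X 0 ω' ∂P)) 2 P :=
  (memLp_finsetSum _ fun j _ => h.memLp_two_dev hL j).const_mul _

/-- Consistency of the sample variance. -/
lemma tendstoInMeasure_sampleVar :
    TendstoInMeasure P (sampleVar X) atTop fun _ => Var[X 0; P] := by
  obtain ⟨C₁, hC₁, h₁⟩ := h.exists_integral_average_sq_le (measurable_sqFun _) (h.memLp_sqFun hL)
  obtain ⟨C₂, hC₂, h₂⟩ := h.exists_integral_mean_sq_le hL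
  have L₁ := h.memLp_average (measurable_sqFun _) (h.memLp_sqFun hL)
  have eV : ∫ ω, sqFun (∫ ω', X 0 ω' ∂P) (pairs X 0 ω) ∂P = Var[X 0; P] := h.integral_sqFun 0
  rw [eV] at h₁ L₁
  have key : TendstoInMeasure P (fun n ω => sampleVar X n ω - Var[X 0; P]) atTop 0 := by
    refine tendstoInMeasure_zero_of_le
      (G := fun n ω => |(1 / (n : ℝ)) * ∑ j ∈ Finset.range n,
          (sqFun (∫ ω', X 0 ω' ∂P) (pairs X j ω) - Var[X 0; P])|
        + ((1 / (n : ℝ)) * ∑ j ∈ Finset.range n, (X j ω - ∫ ω', X 0 ω' ∂P)) ^ 2)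
      (u := fun n : ℕ => √(C₁ / n) + C₂ / n)
      (fun n => ((L₁ n).integrable one_le_two).abs.add (h.memLp_mean hL n).integrable_sq) ?_
      (Eventually.of_forall fun n => ?_) ?_
    · filter_upwards [eventually_gt_atTop 0] with n hn ω
      have hn' : (n : ℝ) ≠ 0 := by exact_mod_cast hn.ne'
      set m : ℝ := (1 / (n : ℝ)) * ∑ j ∈ Finset.range n, (X j ω - ∫ ω', X 0 ω' ∂P) with hm
      have e1 := sum_sub_mean_sq (fun j => X j ω - ∫ ω', X 0 ω' ∂P) n (m := m)
        (by rw [hm]; field_simp)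
      -- Centring at the sample mean instead of `μ` costs exactly `m²`, whose expectation is O(1/n).
      have e2 : sampleVar X n ω - Var[X 0; P] = (1 / (n : ℝ)) * ∑ j ∈ Finset.range n,
          (sqFun (∫ ω', X 0 ω' ∂P) (pairs X j ω) - Var[X 0; P]) + -m ^ 2 := by
        rw [sampleVar, sampleMean_eq hn (∫ ω', X 0 ω' ∂P), ← hm]
        simp_rw [← sub_sub]
        rw [e1, Finset.sum_sub_distrib]
        simp only [sqFun, pairs, Finset.sum_const, Finset.card_range, nsmul_eq_mul]
        field_simp
        ring
      rw [e2]
      refine (abs_add_le _ _).trans ?_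
      rw [abs_neg, abs_of_nonneg (sq_nonneg m)]
    · rw [integral_add ((L₁ n).integrable one_le_two).abs (h.memLp_mean hL n).integrable_sq]
      exact add_le_add ((integral_abs_le_sqrt (L₁ n)).trans (Real.sqrt_le_sqrt (h₁ n))) (h₂ n)
    · have l1 := (tendsto_const_div_atTop_nhds_zero_nat C₁).sqrt
      simpa using l1.add (tendsto_const_div_atTop_nhds_zero_nat C₂)
  rw [tendstoInMeasure_iff_norm] at key ⊢
  simpa using key

/-- The centred sample autocovariance is asymptotically equivalent to an average. -/
lemma tendstoInMeasure_sampleAutocov_sub (ρ V : ℝ) (hV : 0 < V) :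
    TendstoInMeasure P ((fun (n : ℕ) ω => √n * (sampleAutocov X n ω - ρ * sampleVar X n ω) / V)
      - fun (n : ℕ) ω => (√n)⁻¹ * ∑ j ∈ Finset.range n,
        scoreFun (∫ ω', X 0 ω' ∂P) ρ V (pairs X j ω)) atTop 0 := by
  obtain ⟨C, hC, hle⟩ := h.exists_integral_mean_sq_le hL
  set μ : ℝ := ∫ ω', X 0 ω' ∂P with hμ
  have i2 : ∀ i, Integrable (fun ω => (X i ω - μ) ^ 2) P := fun i =>
    (h.memLp_two_dev hL i).integrable_sq
  have iA : ∀ k : ℕ, Integrable (fun ω => (2 * (X (k - 1) ω - μ) ^ 2 + (X k ω - μ) ^ 2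
      + (X 0 ω - μ) ^ 2) / (k : ℝ)) P := fun k =>
    ((((i2 _).const_mul 2).add (i2 _)).add (i2 _)).div_const _
  have iB : ∀ n : ℕ, Integrable (fun ω => (4 + |ρ|) * ((1 / (n : ℝ)) * ∑ j ∈ Finset.range n,
      (X j ω - μ)) ^ 2) P := fun n => (h.memLp_mean hL n).integrable_sq.const_mul _
  refine tendstoInMeasure_zero_of_le
    (G := fun n ω => (√n / V) * ((2 * (X (n - 1) ω - μ) ^ 2 + (X n ω - μ) ^ 2
        + (X 0 ω - μ) ^ 2) / (n : ℝ)
      + (4 + |ρ|) * ((1 / (n : ℝ)) * ∑ j ∈ Finset.range n, (X j ω - μ)) ^ 2))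
    -- The three boundary squares have total mean `(2 + 1 + 1) Var[X 0; P]`, and the squared mean
    -- contributes `C/n`; the prefactor `√n / V` turns the order `1/n` into `1/√n`.
    (u := fun n : ℕ => (V⁻¹ * (4 * Var[X 0; P] + (4 + |ρ|) * C)) * (√(n : ℝ))⁻¹)
    (fun n => ((iA n).add (iB n)).const_mul _) ?_ ?_ ?_
  · filter_upwards [eventually_gt_atTop 0] with n hn ω
    obtain ⟨k, rfl⟩ : ∃ k, n = k + 1 := ⟨n - 1, by omega⟩
    have hn' : (0 : ℝ) < k + 1 := by positivity
    have hs : (0 : ℝ) < √((k + 1 : ℕ) : ℝ) := Real.sqrt_pos.2 (by positivity)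
    have hss : √((k + 1 : ℕ) : ℝ) * √((k + 1 : ℕ) : ℝ) = k + 1 := by
      rw [Real.mul_self_sqrt (by positivity)]; push_cast; rfl
    set m : ℝ := (1 / ((k + 1 : ℕ) : ℝ)) * ∑ j ∈ Finset.range (k + 1), (X j ω - μ) with hm
    have hb := abs_autocov_remainder_le (fun j => X j ω - μ) k (m := m) ρ
      (by rw [hm]; push_cast; field_simp)
    have e : √((k + 1 : ℕ) : ℝ) * (sampleAutocov X (k + 1) ω - ρ * sampleVar X (k + 1) ω) / V
        - (√((k + 1 : ℕ) : ℝ))⁻¹ * ∑ j ∈ Finset.range (k + 1), scoreFun μ ρ V (pairs X j ω)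
        = (√((k + 1 : ℕ) : ℝ) / V) * ((1 / (k + 1 : ℝ)) * ∑ i ∈ Finset.range k,
            ((X i ω - μ) - m) * ((X (i + 1) ω - μ) - m)
          - ρ * ((1 / (k + 1 : ℝ)) * ∑ i ∈ Finset.range (k + 1), ((X i ω - μ) - m) ^ 2)
          - (1 / (k + 1 : ℝ)) * ∑ i ∈ Finset.range (k + 1),
            ((X i ω - μ) * (X (i + 1) ω - μ) - ρ * (X i ω - μ) ^ 2)) := by
      rw [sampleAutocov, sampleVar, sampleMean_eq hn μ, ← hm, Nat.add_sub_cancel]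
      simp_rw [← sub_sub]
      simp only [scoreFun, prodFun, sqFun, pairs]
      rw [← Finset.mul_sum]
      push_cast at hs hss ⊢
      generalize √((k : ℝ) + 1) = q at hs hss ⊢
      rw [← hss]
      field_simp
    change |√((k + 1 : ℕ) : ℝ) * (sampleAutocov X (k + 1) ω - ρ * sampleVar X (k + 1) ω) / V
        - (√((k + 1 : ℕ) : ℝ))⁻¹ * ∑ j ∈ Finset.range (k + 1), scoreFun μ ρ V (pairs X j ω)| ≤ _
    rw [e, abs_mul, abs_of_pos (div_pos hs hV), Nat.add_sub_cancel]
    refine mul_le_mul_of_nonneg_left (hb.trans_eq ?_) (div_pos hs hV).le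
    push_cast
    rfl
  · filter_upwards [eventually_gt_atTop 0] with n hn
    have hn' : (0 : ℝ) < n := by exact_mod_cast hn
    have hs : (0 : ℝ) < √(n : ℝ) := Real.sqrt_pos.2 hn'
    have hss : √(n : ℝ) * √(n : ℝ) = n := Real.mul_self_sqrt hn'.le
    rw [integral_const_mul, integral_add (iA n) (iB n), integral_const_mul, integral_div]
    have e1 : ∫ ω, (2 * (X (n - 1) ω - μ) ^ 2 + (X n ω - μ) ^ 2 + (X 0 ω - μ) ^ 2) ∂P
        = 4 * Var[X 0; P] := by
      have i3 : Integrable (fun ω => 2 * (X (n - 1) ω - μ) ^ 2) P := (i2 _).const_mul 2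
      have i4 : Integrable (fun ω => 2 * (X (n - 1) ω - μ) ^ 2 + (X n ω - μ) ^ 2) P :=
        i3.add (i2 _)
      rw [integral_add i4 (i2 0), integral_add i3 (i2 n), integral_const_mul, h.integral_sqFun,
        h.integral_sqFun, h.integral_sqFun]
      ring
    rw [e1]
    calc _ ≤ (√n / V) * (4 * Var[X 0; P] / n + (4 + |ρ|) * (C / n)) := by
          gcongr
          exact hle n
      _ = _ := by
          clear hle iA iB
          generalize √(n : ℝ) = q at hs hss ⊢
          rw [← hss]
          field_simp
  · have hsq : Tendsto (fun n : ℕ => (√(n : ℝ))⁻¹) atTop (𝓝 0) :=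
      (Real.tendsto_sqrt_atTop.comp tendsto_natCast_atTop_atTop).inv_tendsto_atTop
    simpa using hsq.const_mul (V⁻¹ * (4 * Var[X 0; P] + (4 + |ρ|) * C))

/-- Asymptotic normality of the first-order sample autocorrelation. -/
theorem tendstoInDistribution_sampleAutocorr (hV : 0 < Var[X 0; P]) :
    TendstoInDistribution
      (fun (n : ℕ) (ω : Ω) => √(n : ℝ) * (sampleAutocorr X n ω - autocorr X P))
      atTop (id : ℝ → ℝ) (fun _ => P) (gaussianReal 0 (gammaSq X P).toNNReal) := by
  set V : ℝ := Var[X 0; P] with hVdef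
  set ρ : ℝ := autocorr X P with hρ
  have mD := measurable_sampleVar h.meas
  have mN := measurable_sampleAutocov h.meas
  have mR : ∀ n, Measurable (sampleAutocorr X n) := fun n => (mN n).div (mD n)
  have hD := h.tendstoInMeasure_sampleVar hL
  set T : ℕ → Ω → ℝ := fun n ω => √n * (sampleAutocov X n ω - ρ * sampleVar X n ω) / V with hT
  have mT : ∀ n, Measurable (T n) := fun n =>
    (((mN n).sub ((mD n).const_mul ρ)).const_mul _).div_const _
  have hTlim : TendstoInDistribution T atTop (id : ℝ → ℝ) (fun _ => P)
      (gaussianReal 0 (gammaSq X P).toNNReal) :=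
    tendstoInDistribution_of_tendstoInMeasure_sub T id (h.tendstoInDistribution_score hL hV)
      (h.tendstoInMeasure_sampleAutocov_sub hL ρ V hV) fun n => (mT n).aemeasurable
  -- Capping the denominator from below at `V/2` makes the quotient map continuous everywhere, as
  -- the continuous mapping theorem requires; at the limit value `V` the cap is inactive.
  have hmax : ∀ d : ℝ, max d (V / 2) ≠ 0 := fun d =>
    (lt_of_lt_of_le (half_pos hV) (le_max_right _ _)).ne'
  have hg : Continuous fun z : ℝ × ℝ => z.1 * V / max z.2 (V / 2) :=
    (continuous_fst.mul continuous_const).div (continuous_snd.max continuous_const)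
      fun z => hmax z.2
  have hlim := hTlim.continuous_comp_prodMk_of_tendstoInMeasure_const hg hD
    fun n => (mD n).aemeasurable
  have elim : (fun x : ℝ => id x * V / max V (V / 2)) = id := by
    ext x
    rw [max_eq_left (half_le_self hV.le), mul_div_cancel_right₀ _ hV.ne']
  change TendstoInDistribution _ _ (fun x : ℝ => id x * V / max V (V / 2)) _ _ at hlim
  rw [elim] at hlim
  refine tendstoInDistribution_of_tendstoInMeasure_sub _ _ hlim ?_
    fun n => (((mR n).sub_const _).const_mul _).aemeasurable
  rw [tendstoInMeasure_iff_measureReal_norm] at hD ⊢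
  intro ε hε
  -- Where the sample variance is within `V/2` of `V`, the capped and the true quotient coincide; so
  -- they differ only on an event whose probability tends to 0 by consistency.
  refine squeeze_zero (fun _ => measureReal_nonneg) (fun n => measureReal_mono fun ω hω => ?_)
    (hD (V / 2) (half_pos hV))
  by_contra hcon
  simp only [Set.mem_ofPred_eq, not_le, Real.norm_eq_abs] at hcon
  have hle : V / 2 ≤ sampleVar X n ω := by linarith [(abs_lt.1 hcon).1]
  have hpos : 0 < sampleVar X n ω := (half_pos hV).trans_le hle
  have e : √(n : ℝ) * (sampleAutocorr X n ω - ρ) = T n ω * V / max (sampleVar X n ω) (V / 2) := by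
    have e' : sampleAutocorr X n ω = sampleAutocov X n ω / sampleVar X n ω := rfl
    rw [max_eq_left hle, hT, e']
    field_simp
  have hω' : ε ≤ |√(n : ℝ) * (sampleAutocorr X n ω - ρ)
      - T n ω * V / max (sampleVar X n ω) (V / 2)| := by simpa using hω
  rw [e, sub_self, abs_zero] at hω'
  linarith

end CovDecay

end Slutsky
end TimeSeries

/-! ### The limit theorem for the sample autocorrelation -/

theorem mainTheorem4 {Ω : Type*} [MeasurableSpace Ω] (P : Measure Ω) [IsProbabilityMeasure P]
    (X : ℕ → Ω → ℝ) (hmeas : ∀ i, Measurable (X i))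
    (hstat : TimeSeries.StrictlyStationary X P)
    (hvar : 0 < Var[X 0; P])
    (hcase :
      (∃ m : ℕ, TimeSeries.MDependent X P m ∧ MemLp (X 0) 4 P) ∨
      (TimeSeries.AlphaMixing X P ∧
        ∃ δ : ℝ, 0 < δ ∧ MemLp (X 0) (ENNReal.ofReal (4 + 2 * δ)) P ∧
          Summable (fun n : ℕ => TimeSeries.alphaCoeff X P (n + 1) ^ (δ / (2 + δ))))) :
    -- the series that define the long-run variances and covariance converge absolutely
    Summable (fun k : ℕ =>
      cov[TimeSeries.lagProd X P 0, TimeSeries.lagProd X P (k + 1); P]) ∧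
    Summable (fun k : ℕ =>
      cov[TimeSeries.centredSq X P 0, TimeSeries.centredSq X P (k + 1); P]) ∧
    Summable (fun k : ℕ =>
      cov[TimeSeries.centredSq X P 0, TimeSeries.lagProd X P (k + 1); P]) ∧
    Summable (fun k : ℕ =>
      cov[TimeSeries.lagProd X P 0, TimeSeries.centredSq X P (k + 1); P]) ∧
    0 ≤ TimeSeries.gammaSq X P ∧
    TendstoInDistribution
      (fun (n : ℕ) (ω : Ω) =>
        √(n : ℝ) * (TimeSeries.sampleAutocorr X n ω - TimeSeries.autocorr X P))
      atTop (id : ℝ → ℝ) (fun _ => P)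
      (gaussianReal 0 (TimeSeries.gammaSq X P).toNNReal) := by
  obtain ⟨p, a, c, h, hL⟩ : ∃ (p : ℝ) (a c : ℕ → ℝ), TimeSeries.CovDecay X P p a c ∧
      MemLp (X 0) (ENNReal.ofReal (2 * p)) P := by
    -- The exponent `p` is half the order of the assumed moments: 2 for fourth moments, `2 + δ` for
    -- moments of order `4 + 2δ`.
    rcases hcase with ⟨m, hm, hL⟩ | ⟨-, δ, hδ, hL, hsum⟩
    · refine ⟨2, _, _, hm.covDecay hmeas hstat, ?_⟩
      rw [show ENNReal.ofReal (2 * 2) = 4 by norm_num]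
      exact hL
    · refine ⟨2 + δ, _, _, TimeSeries.covDecay_of_summable hδ hmeas hstat hsum, ?_⟩
      rw [show 2 * (2 + δ) = 4 + 2 * δ by ring]
      exact hL
  exact ⟨h.summable_cov_lagProd_lagProd hL, h.summable_cov_centredSq_centredSq hL,
    h.summable_cov_centredSq_lagProd hL, h.summable_cov_lagProd_centredSq hL,
    h.gammaSq_nonneg hL hvar, h.tendstoInDistribution_sampleAutocorr hL hvar⟩
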